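/- Let $n=2$. Let $\sigma_1,\sigma_2,\sigma_3$ be the left-invariant coframe on $S^3=SU(2)$ for which $\sigma_1^2+\sigma_2^2+\sigma_3^2$ is the unit round metric, let $\Gamma_n=\mathbb Z/n\mathbb Z$ act on $\mathbb C^2$ by scalars, and let $$g_{LEB(n)}=\frac{1+\hat r^2}{n+\hat r^2}\,d\hat r^2+(1+\hat r^2)(\sigma_1^2+\sigma_2^2)+\frac{\hat r^2(n+\hat r^2)}{1+\hat r^2}\,\sigma_3^2,\qquad \hat r\in(0,\infty),$$ be the LeBrun metric on $((0,\infty)\times S^3)/\Gamma_n$. It extends smoothly to $\mathcal O_{\mathbb P^1}(-n)$ by attaching a $\mathbb P^1$ at $\hat r=0$; for $n=2$ it is the Eguchi–Hanson metric. Let $\check g_{LEB(n)}=(n+\hat r^2)^{-2}g_{LEB(n)}$ be its conformal compactification on the compact orbifold $\check{\mathcal O}_{\mathbb P^1}(-n)=\mathcal O_{\mathbb P^1}(-n)\cup\{\check q\}$, which has one orbifold point $\check q$ at $\hat r=\infty$, with group $\Gamma_n$. Put $s=1/\hat r$. Let $\mathcal X_n$ be the set of smooth, $U(2)$-invariant,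 positive functions on $\check{\mathcal O}_{\mathbb P^1}(-n)$ (smoothness at $\check q$ means smoothness of the lift to a uniformizing chart); such a function is a function of $s$. Let $\mathcal Y_n$ be the set of functions on $(0,\infty)$ of the form $h(s)=f(s)/(n+1/s^2)$ with $f\in\mathcal X_n$. Suppose $K\in\mathcal X_2$ satisfies $K'(s)\le 0$ for every $s\ge 0$. Then there is no $v\in\mathcal Y_2$ such that $$\Delta_{g_{LEB(2)}}v=-Kv^3 .$$ Consequently, there is no $u\in\mathcal X_2$, that is, no positive smooth $U(2)$-invariant function on $\check{\mathcal O}_{\mathbb P^1}(-2)$, such that $$-\Delta_{\check g_{LEB(2)}}u+\tfrac16R_{\check g_{LEB(2)}}u=Ku^3,$$ where $R_{\check g_{LEB(2)}}$ is the scalar curvature of $\check g_{LEB(2)}$. -/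

import Mathlib

open scoped ContDiff BigOperators Matrix

noncomputable section

namespace LeBrun

/-! ### The compactified orbifold

Every nonzero `(z, w) ∈ ℂ² × ℂ` represents a point; two representatives are identified by positive
rescaling and by the circle action `λ · (z, w) = (λ z, λ⁻ⁿ w)`. The points with `z ≠ 0` form the
line bundle `S³ ×_{U(1)} ℂ = 𝒪(-n)` over `ℙ¹` (zero section `w = 0`), whose radial coordinate is
`r̂ = |w| / |z|`; the remaining point `[0 : 0 : 1]` is the orbifold point at `r̂ = ∞`, where
`s = 1 / r̂ = |z| / |w|` vanishes. -/

/-- Nonzero vectors of `ℂ² × ℂ`. -/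
abbrev Cone : Type := {p : (Fin 2 → ℂ) × ℂ // p ≠ 0}

/-- The identification `(z, w) ∼ (t λ z, t λ⁻ⁿ w)` for `t > 0` and `|λ| = 1`. -/
def coneSetoid (n : ℕ) : Setoid Cone where
  r p q := ∃ t : ℝ, 0 < t ∧ ∃ c : Circle,
    q.1.1 = ((t : ℂ) * (c : ℂ)) • p.1.1 ∧ q.1.2 = ((t : ℂ) * ((c⁻¹ : Circle) : ℂ) ^ n) * p.1.2
  iseqv :=
    { refl := fun p => ⟨1, one_pos, 1, by simp, by simp⟩
      symm := by
        rintro p q ⟨t, ht, c, h1, h2⟩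
        have ht' : (t : ℂ) ≠ 0 := by exact_mod_cast ht.ne'
        refine ⟨t⁻¹, inv_pos.2 ht, c⁻¹, ?_, ?_⟩
        · rw [h1, smul_smul]
          have : ((t⁻¹ : ℝ) : ℂ) * ((c⁻¹ : Circle) : ℂ) * ((t : ℂ) * (c : ℂ)) = 1 := by
            rw [Circle.coe_inv]; push_cast
            have := Circle.coe_ne_zero c
            field_simp
          rw [this, one_smul]
        · rw [h2]
          have hc := Circle.coe_ne_zero c
          have hcc : ((c : ℂ)) ^ n * ((c : ℂ)⁻¹) ^ n = 1 := by
            rw [← mul_pow, mul_inv_cancel₀ hc, one_pow]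
          rw [inv_inv, Circle.coe_inv, Complex.ofReal_inv]
          calc p.1.2 = ((t : ℂ)⁻¹ * t) * ((c : ℂ) ^ n * ((c : ℂ)⁻¹) ^ n) * p.1.2 := by
                rw [hcc, inv_mul_cancel₀ ht']; ring
            _ = _ := by ring
      trans := by
        rintro p q r ⟨t, ht, c, h1, h2⟩ ⟨t', ht', c', h1', h2'⟩
        refine ⟨t' * t, mul_pos ht' ht, c' * c, ?_, ?_⟩
        · rw [h1', h1, smul_smul]; congr 1; push_cast; ring
        · rw [h2', h2, mul_inv]; push_cast; ring }

/-- The one-point (orbifold) compactification of `𝒪_{ℙ¹}(-n)`. -/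
def Orb (n : ℕ) : Type := Quotient (coneSetoid n)

/-- The point represented by a nonzero `(z, w)`. -/
def Orb.mk (n : ℕ) (z : Fin 2 → ℂ) (w : ℂ) (h : (z, w) ≠ 0) : Orb n :=
  Quotient.mk (coneSetoid n) ⟨(z, w), h⟩

/-- `U(2)` acts on `ℂ² × ℂ` by `A · (z, w) = (A z, w)`. -/
def coneAct (A : Matrix.unitaryGroup (Fin 2) ℂ) (p : Cone) : Cone :=
  ⟨((A : Matrix (Fin 2) (Fin 2) ℂ) *ᵥ p.1.1, p.1.2), by
    intro h
    apply p.2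
    have h1 : (A : Matrix (Fin 2) (Fin 2) ℂ) *ᵥ p.1.1 = 0 := congrArg Prod.fst h
    have h2 : p.1.2 = 0 := congrArg Prod.snd h
    refine Prod.ext ?_ h2
    have hA : star (A : Matrix (Fin 2) (Fin 2) ℂ) * (A : Matrix (Fin 2) (Fin 2) ℂ) = 1 :=
      Matrix.mem_unitaryGroup_iff'.1 A.2
    calc p.1.1 = (star (A : Matrix (Fin 2) (Fin 2) ℂ) * (A : Matrix (Fin 2) (Fin 2) ℂ))
            *ᵥ p.1.1 := by rw [hA, Matrix.one_mulVec]
      _ = 0 := by rw [← Matrix.mulVec_mulVec, h1, Matrix.mulVec_zero]⟩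

/-- The induced action of `U(2)` on the orbifold. -/
def Orb.act (n : ℕ) (A : Matrix.unitaryGroup (Fin 2) ℂ) : Orb n → Orb n :=
  Quotient.map' (s₁ := coneSetoid n) (s₂ := coneSetoid n) (coneAct A) (by
    rintro p q ⟨t, ht, c, h1, h2⟩
    refine ⟨t, ht, c, ?_, h2⟩
    show (A : Matrix (Fin 2) (Fin 2) ℂ) *ᵥ q.1.1 = _ • ((A : Matrix (Fin 2) (Fin 2) ℂ) *ᵥ p.1.1)
    rw [h1, Matrix.mulVec_smul])

/-- `ℝ⁴` with its Euclidean norm, identified with `ℂ²` by `(x₀ + i x₁, x₂ + i x₃)`. -/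
abbrev E4 : Type := EuclideanSpace ℝ (Fin 4)

/-- First complex coordinate. -/
def cx (x : E4) : ℂ := ⟨x 0, x 1⟩

/-- Second complex coordinate. -/
def cy (x : E4) : ℂ := ⟨x 2, x 3⟩

/-- Uniformizing chart at the orbifold point, `ℂ² → ℂ² / Γₙ`, with `s = ‖x‖`. -/
def chartOrb (n : ℕ) (x : E4) : Orb n :=
  Orb.mk n ![cx x, cy x] 1 (fun h => one_ne_zero (congrArg Prod.snd h))

/-- First bundle chart of `𝒪(-n)`: base coordinate `ζ = z₂ / z₁`, linear fibre coordinate. -/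
def chartBdl₁ (n : ℕ) (x : E4) : Orb n :=
  Orb.mk n ![1, cx x] (cy x) (fun h => one_ne_zero (congrFun (congrArg Prod.fst h) 0))

/-- Second bundle chart of `𝒪(-n)`: base coordinate `z₁ / z₂`, linear fibre coordinate. -/
def chartBdl₂ (n : ℕ) (x : E4) : Orb n :=
  Orb.mk n ![cx x, 1] (cy x) (fun h => one_ne_zero (congrFun (congrArg Prod.fst h) 1))

/-- Smooth functions on the orbifold: smooth in the two charts covering `𝒪(-n)`, and with a smooth
lift to the uniformizing chart at the orbifold point. -/
def IsSmooth (n : ℕ) (f : Orb n → ℝ) : Prop :=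
  ContDiff ℝ ∞ (fun x => f (chartBdl₁ n x)) ∧
  ContDiff ℝ ∞ (fun x => f (chartBdl₂ n x)) ∧
  ContDiff ℝ ∞ (fun x => f (chartOrb n x))

/-- The space `𝒳ₙ` of smooth, `U(2)`-invariant, positive functions on the orbifold. -/
def X (n : ℕ) : Set (Orb n → ℝ) :=
  {f | IsSmooth n f ∧ (∀ A p, f (Orb.act n A p) = f p) ∧ ∀ p, 0 < f p}

/-- A `U(2)`-invariant function as a function of the radial coordinate `s`. -/
def radial {n : ℕ} (f : Orb n → ℝ) (s : ℝ) : ℝ := f (chartOrb n (EuclideanSpace.single 0 s))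

/-- The space `𝒴ₙ`: functions `h(s) = f(s) / (n + 1 / s²)` on `(0, ∞)` with `f ∈ 𝒳ₙ`; the values of
`h` outside `(0, ∞)` play no role. -/
def Y (n : ℕ) : Set (ℝ → ℝ) :=
  {h | ∃ f ∈ X n, ∀ s : ℝ, 0 < s → h s = radial f s / (n + 1 / s ^ 2)}

/-! ### Riemannian geometry in coordinates -/

/-- Partial derivative. -/
def pd (i : Fin 4) (f : E4 → ℝ) (x : E4) : ℝ := fderiv ℝ f x (EuclideanSpace.single i 1)

/-- Matrix of coefficients of a metric. -/
abbrev MetricField : Type := E4 → Matrix (Fin 4) (Fin 4) ℝ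

/-- Laplace–Beltrami operator `(det g)^{-1/2} ∂ᵢ ((det g)^{1/2} gⁱʲ ∂ⱼ f)`. -/
def laplacian (g : MetricField) (f : E4 → ℝ) (x : E4) : ℝ :=
  (√(g x).det)⁻¹ *
    ∑ i, pd i (fun y => √(g y).det * ∑ j, (g y)⁻¹ i j * pd j f y) x

/-- Christoffel symbol `Γᵏᵢⱼ`. -/
def christoffel (g : MetricField) (k i j : Fin 4) (x : E4) : ℝ :=
  (1 / 2) * ∑ l, (g x)⁻¹ k l *
    (pd i (fun y => g y j l) x + pd j (fun y => g y i l) x - pd l (fun y => g y i j) x)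

/-- Ricci tensor `∂ₖ Γᵏᵢⱼ - ∂ⱼ Γᵏᵢₖ + Γᵏᵢⱼ Γˡₖₗ - Γᵏᵢₗ Γˡⱼₖ`. -/
def ricci (g : MetricField) (i j : Fin 4) (x : E4) : ℝ :=
  ∑ k, (pd k (christoffel g k i j) x - pd j (christoffel g k i k) x +
    ∑ l, (christoffel g k i j x * christoffel g l k l x -
      christoffel g k i l x * christoffel g l j k x))

/-- Scalar curvature. -/
def scalarCurvature (g : MetricField) (x : E4) : ℝ :=
  ∑ i, ∑ j, (g x)⁻¹ i j * ricci g i j x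

/-! ### The LeBrun metric

The region `0 < s < ∞` of the orbifold is `(ℂ² \ {0}) / Γₙ`. Both metrics are written there in the
uniformizing chart, whose points are `x = s θ` with `s = 1 / r̂ > 0` and `θ ∈ S³`. -/

/-- The radial coordinate `r̂ = 1 / s`. -/
def rhat (x : E4) : ℝ := 1 / ‖x‖

/-- The differential of `r̂`. -/
def drhat (x : E4) : Fin 4 → ℝ := fun i => - x i / ‖x‖ ^ 3

/-- The left-invariant coframe of `S³ = SU(2)`, pulled back by `x ↦ x / ‖x‖`, with
`σ₁² + σ₂² + σ₃²` the unit round metric and `σ₃` dual to the Hopf direction `i x`. -/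
def sigma₁ (x : E4) : Fin 4 → ℝ := fun i => ![- x 2, x 3, x 0, - x 1] i / ‖x‖ ^ 2

/-- Second form of the coframe. -/
def sigma₂ (x : E4) : Fin 4 → ℝ := fun i => ![- x 3, - x 2, x 1, x 0] i / ‖x‖ ^ 2

/-- Third form of the coframe. -/
def sigma₃ (x : E4) : Fin 4 → ℝ := fun i => ![- x 1, x 0, - x 3, x 2] i / ‖x‖ ^ 2

/-- The square of a one-form. -/
def sq (a : Fin 4 → ℝ) : Matrix (Fin 4) (Fin 4) ℝ := Matrix.vecMulVec a a

/-- The metric `(1+r̂²)/(n+r̂²) dr̂² + (1+r̂²)(σ₁² + σ₂²) + r̂²(n+r̂²)/(1+r̂²) σ₃²`. -/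
def gLEB (n : ℕ) : MetricField := fun x =>
  ((1 + rhat x ^ 2) / (n + rhat x ^ 2)) • sq (drhat x) +
  (1 + rhat x ^ 2) • sq (sigma₁ x) + (1 + rhat x ^ 2) • sq (sigma₂ x) +
  (rhat x ^ 2 * (n + rhat x ^ 2) / (1 + rhat x ^ 2)) • sq (sigma₃ x)

/-- The conformal compactification `(n + r̂²)⁻² g_{LEB(n)}`. -/
def gLEBc (n : ℕ) : MetricField := fun x => (1 / (n + rhat x ^ 2) ^ 2) • gLEB n x

/-- The radial function `v = v(s)` satisfies `Δ v = -K v³` for `g_{LEB(n)}` where `0 < s < ∞`. (By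
continuity this is the same as on all of `𝒪(-n)` for a function that is smooth across `ℙ¹`.) -/
def SolvesALE (n : ℕ) (K : Orb n → ℝ) (v : ℝ → ℝ) : Prop :=
  ∀ x : E4, x ≠ 0 →
    laplacian (gLEB n) (fun y => v ‖y‖) x = - K (chartOrb n x) * v ‖x‖ ^ 3

/-- The function `u` satisfies `-Δ u + R u / 6 = K u³` for the compactified metric where
`0 < s < ∞`. (By continuity this is the same as on the whole orbifold for a smooth `u`.) -/
def SolvesConf (n : ℕ) (K u : Orb n → ℝ) : Prop :=
  ∀ x : E4, x ≠ 0 →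
    - laplacian (gLEBc n) (fun y => u (chartOrb n y)) x +
        (1 / 6) * scalarCurvature (gLEBc n) x * u (chartOrb n x) =
      K (chartOrb n x) * u (chartOrb n x) ^ 3

end LeBrun

end

/-!
In the coordinate `s = 1 / r̂` the equation `Δ v = -K v³` for a radial function reads
`(q v')' = -ρ K v³` with `q = (n s² + 1) / s` and `ρ = (1 + s²) / s⁵`, and the compactified equation
for `u` becomes the same one under `v = u / (n + r̂²)`. Multiplying by `L q v' - 2 v`, where
`L' = 4 / q` and `L 0 = 0`, produces a Pohozaev function that tends to `0` at both ends of `(0, ∞)`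
and whose derivative is `v⁴ / 2 * (L ρ q K' + (12 ρ + L (ρ q)') K)`. For `n ≥ 2` a Padé bound for
the logarithm makes `12 ρ + L (ρ q)'` negative, so the Pohozaev function decreases strictly from `0`
as long as `K > 0 ≥ K'`. This contradicts its limit at infinity if `K` is positive throughout; and
if `K` vanishes at some `a`, then `q v'` increases to `0` on `[a, ∞)`, so `q v' ≤ 0` at `a`, where
the Pohozaev function is therefore nonnegative. Moreover `K` is positive somewhere, since otherwise
`q v'`, which has a positive limit at `s = 0`, would be at most `0` everywhere.
-/

noncomputable section

namespace LeBrun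

open Filter Topology Set

/-! ### The radial equation -/

lemma hasDerivAt_const_mul_sq_add_one (n s : ℝ) :
    HasDerivAt (fun s : ℝ => n * s ^ 2 + 1) (2 * n * s) s := by
  refine (((hasDerivAt_pow 2 s).const_mul n).add_const 1).congr_deriv ?_
  push_cast
  ring

-- The left-hand side is the `[2/2]` Padé approximant of `log (1 + y)` at `y = 0`.
lemma pade_lt_log_one_add {y : ℝ} (hy : 0 < y) :
    3 * y * (y + 2) / (y ^ 2 + 6 * y + 6) < Real.log (1 + y) := by
  let gap : ℝ → ℝ := fun y => Real.log (1 + y) - 3 * y * (y + 2) / (y ^ 2 + 6 * y + 6)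
  have hgap : ∀ y : ℝ, 0 ≤ y →
      HasDerivAt gap (y ^ 4 / ((1 + y) * (y ^ 2 + 6 * y + 6) ^ 2)) y := by
    intro y hy
    have hlog := ((hasDerivAt_id y).const_add 1).log (x := y) (by simp only [id]; positivity)
    have hnum := ((hasDerivAt_id y).const_mul 3).mul ((hasDerivAt_id y).add_const 2)
    have hden := ((hasDerivAt_pow 2 y).add ((hasDerivAt_id y).const_mul 6)).add_const 6
    refine (hlog.sub (hnum.div hden (by simp only [id, Pi.add_apply]; positivity))).congr_deriv ?_
    simp only [id, Pi.mul_apply, Pi.add_apply, Nat.cast_ofNat]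
    field_simp
    ring
  have hmono : StrictMonoOn gap (Ici 0) := by
    refine strictMonoOn_of_deriv_pos (convex_Ici 0)
      (fun y hy => (hgap y hy).continuousAt.continuousWithinAt) fun y hy => ?_
    rw [interior_Ici, mem_Ioi] at hy
    rw [(hgap y hy.le).deriv]
    positivity
  have hpos : gap 0 < gap y := hmono self_mem_Ici hy.le hy
  simpa [gap] using hpos

lemma mul_lt_log_mul {n x : ℝ} (hn : 2 ≤ n) (hx : 0 < x) :
    6 * n * x * (1 + x) < Real.log (n * x + 1) * (2 * n * x ^ 2 + 4 * (n + 1) * x + 6) := by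
  have hn0 : 0 < n := by linarith
  have hpade := pade_lt_log_one_add (mul_pos hn0 hx)
  have hden : 0 < (n * x) ^ 2 + 6 * (n * x) + 6 := by positivity
  have hquad : 0 < 2 * n * x ^ 2 + 4 * (n + 1) * x + 6 := by positivity
  rw [add_comm (n * x) 1]
  refine lt_of_le_of_lt ?_ (mul_lt_mul_of_pos_right hpade hquad)
  rw [div_mul_eq_mul_div, le_div_iff₀ hden, ← sub_nonneg]
  -- `(n x + 2)(n x² + 2(n+1)x + 3) - (1 + x)(n² x² + 6 n x + 6) = (n - 2)(n x² + x)`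
  have hgap : 0 ≤ 6 * n * x * ((n - 2) * (n * x ^ 2 + x)) :=
    mul_nonneg (by positivity) (mul_nonneg (by linarith) (by positivity))
  linear_combination hgap

/-- The flux `q v'` with `q = (n s² + 1) / s`: in the coordinate `s`, the LeBrun Laplacian of a
radial function `v` is `(q v')'` divided by `sourceWeight`. -/
def flux (n : ℝ) (v : ℝ → ℝ) (s : ℝ) : ℝ := (n * s ^ 2 + 1) / s * deriv v s

/-- The weight `ρ = (1 + s²) / s⁵` in the radial equation `(q v')' = -ρ K v³`. -/
def sourceWeight (s : ℝ) : ℝ := (1 + s ^ 2) / s ^ 5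

/-- The primitive `L` of `4 / q`, where `q = (n s² + 1) / s`, that vanishes at `s = 0`. -/
def multiplier (n s : ℝ) : ℝ := 2 / n * Real.log (n * s ^ 2 + 1)

/-- The Pohozaev function of the radial equation, obtained by multiplying the equation with
`L q v' - 2 v` and integrating. -/
def pohozaev (n : ℝ) (K v : ℝ → ℝ) (s : ℝ) : ℝ :=
  multiplier n s *
    (flux n v s ^ 2 + sourceWeight s * ((n * s ^ 2 + 1) / s) * K s * v s ^ 4 / 2) -
  4 * v s * flux n v s

/-- Positive solutions of `(q v')' = -ρ K v³` on `(0, ∞)` that extend regularly to both ends: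
`v / s²` is smooth and positive at `s = 0`, and `v` is a smooth function of `r = 1 / s` at
`r = 0`. -/
structure IsRegularSolution (n : ℝ) (K v : ℝ → ℝ) : Prop where
  pos : ∀ s, 0 < s → 0 < v s
  deriv_flux : ∀ s, 0 < s → deriv (flux n v) s = -(sourceWeight s * K s * v s ^ 3)
  regular_zero : ∃ g : ℝ → ℝ, ContDiff ℝ ∞ g ∧ 0 < g 0 ∧ ∀ s, 0 < s → v s = s ^ 2 * g s
  regular_infty : ∃ ψ : ℝ → ℝ, ContDiff ℝ ∞ ψ ∧ ∀ s, 0 < s → v s = ψ s⁻¹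

lemma sourceWeight_pos {s : ℝ} (hs : 0 < s) : 0 < sourceWeight s := by
  unfold sourceWeight; positivity

lemma multiplier_pos {n s : ℝ} (hn : 0 < n) (hs : 0 < s) : 0 < multiplier n s :=
  mul_pos (by positivity) (Real.log_pos (by simpa using by positivity))

lemma hasDerivAt_multiplier {n : ℝ} (hn : 0 < n) (s : ℝ) :
    HasDerivAt (multiplier n) (4 * s / (n * s ^ 2 + 1)) s := by
  have hne : n * s ^ 2 + 1 ≠ 0 := by positivity
  refine (((hasDerivAt_const_mul_sq_add_one n s).log hne).const_mul (2 / n)).congr_deriv ?_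
  field_simp
  ring

lemma hasDerivAt_sourceWeight_mul (n : ℝ) {s : ℝ} (hs : 0 < s) :
    HasDerivAt (fun s => sourceWeight s * ((n * s ^ 2 + 1) / s))
      (-(2 * n * s ^ 4 + 4 * (n + 1) * s ^ 2 + 6) / s ^ 7) s := by
  have hnum := ((hasDerivAt_pow 2 s).const_add 1).div (hasDerivAt_pow 5 s) (by positivity)
  have hquot := (hasDerivAt_const_mul_sq_add_one n s).div (hasDerivAt_id s) hs.ne'
  refine (hnum.mul hquot).congr_deriv ?_
  simp only [Pi.div_apply, id, Nat.cast_ofNat, Nat.add_one_sub_one]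
  field_simp
  ring

lemma sourceWeight_add_multiplier_mul_neg {n s : ℝ} (hn : 2 ≤ n) (hs : 0 < s) :
    12 * sourceWeight s +
      multiplier n s * (-(2 * n * s ^ 4 + 4 * (n + 1) * s ^ 2 + 6) / s ^ 7) < 0 := by
  have hn0 : 0 < n := by linarith
  have hlog := mul_lt_log_mul hn (show 0 < s ^ 2 by positivity)
  have hscale : 0 < 2 / (n * s ^ 7) := div_pos two_pos (mul_pos hn0 (pow_pos hs 7))
  have hneg := mul_neg_of_pos_of_neg hscale (sub_neg.2 hlog)
  refine hneg.trans_eq' ?_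
  rw [sourceWeight, multiplier]
  field_simp
  ring

lemma hasDerivAt_pohozaev_of_ode {q ρ L K v p : ℝ → ℝ} {s v' w' K' : ℝ} (hq : q s ≠ 0)
    (hL : HasDerivAt L (4 / q s) s) (hw : HasDerivAt (fun s => ρ s * q s) w' s)
    (hK : HasDerivAt K K' s) (hv : HasDerivAt v v' s) (hpv : p s = q s * v')
    (hp : HasDerivAt p (-(ρ s * K s * v s ^ 3)) s) :
    HasDerivAt (fun s => L s * (p s ^ 2 + ρ s * q s * K s * v s ^ 4 / 2) - 4 * v s * p s)
      (v s ^ 4 / 2 * (L s * (ρ s * q s) * K' + (12 * ρ s + L s * w') * K s)) s := by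
  have hsum := (hp.pow 2).add (((hw.mul hK).mul (hv.pow 4)).div_const 2)
  refine ((hL.mul hsum).sub ((hv.const_mul 4).mul hp)).congr_deriv ?_
  simp only [Pi.add_apply, Pi.mul_apply, Pi.pow_apply, Nat.cast_ofNat, Nat.add_one_sub_one, hpv]
  field_simp
  ring

lemma hasDerivAt_of_eq_comp_inv {f χ : ℝ → ℝ} {s χ' : ℝ} (hχ : HasDerivAt χ χ' s⁻¹)
    (hf : ∀ s, 0 < s → f s = χ s⁻¹) (hs : 0 < s) : HasDerivAt f (-(s⁻¹ ^ 2 * χ')) s := by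
  refine ((hχ.comp s (hasDerivAt_inv hs.ne')).congr_of_eventuallyEq
    (eventually_of_mem (Ioi_mem_nhds hs) hf)).congr_deriv ?_
  rw [inv_pow, mul_neg, mul_comm]

lemma tendsto_multiplier_inv_mul {n : ℝ} (hn : 0 < n) :
    Tendsto (fun r => multiplier n r⁻¹ * r) (𝓝[>] 0) (𝓝 0) := by
  have hne : ∀ r : ℝ, n + r ^ 2 ≠ 0 := fun r => by positivity
  have hcont : Continuous fun r : ℝ => Real.log (n + r ^ 2) * r :=
    (Continuous.log (by fun_prop) hne).mul continuous_id
  have hlog : Tendsto (fun r : ℝ => Real.log r * r) (𝓝[>] 0) (𝓝 0) := by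
    simpa using tendsto_log_mul_rpow_nhdsGT_zero one_pos
  have hlim := ((hcont.tendsto' 0 0 (by simp)).mono_left nhdsWithin_le_nhds).sub (hlog.const_mul 2)
  rw [mul_zero, sub_zero] at hlim
  refine (mul_zero (2 / n) ▸ hlim.const_mul (2 / n)).congr' ?_
  filter_upwards [self_mem_nhdsWithin] with r hr
  have hr : r ≠ 0 := (mem_Ioi.1 hr).ne'
  have hsplit : n * r⁻¹ ^ 2 + 1 = (n + r ^ 2) / r ^ 2 := by field_simp
  rw [multiplier, hsplit, Real.log_div (hne r) (pow_ne_zero 2 hr), Real.log_pow]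
  push_cast
  ring

lemma contDiffOn_flux (n : ℝ) {v : ℝ → ℝ} (hv : ContDiffOn ℝ ∞ v (Ioi 0)) :
    ContDiffOn ℝ ∞ (flux n v) (Ioi 0) := by
  have hv' : ContDiffOn ℝ ∞ (deriv v) (Ioi 0) := hv.deriv_of_isOpen isOpen_Ioi (by simp)
  have hnum : ContDiff ℝ ∞ fun s : ℝ => n * s ^ 2 + 1 := by fun_prop
  exact (hnum.contDiffOn.div contDiffOn_id fun s hs => (mem_Ioi.1 hs).ne').mul hv'

namespace IsRegularSolution

variable {n : ℝ} {K v : ℝ → ℝ}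

lemma contDiffOn (hv : IsRegularSolution n K v) : ContDiffOn ℝ ∞ v (Ioi 0) := by
  obtain ⟨g, hg, -, hvg⟩ := hv.regular_zero
  exact ((contDiff_id.pow 2).mul hg).contDiffOn.congr hvg

lemma hasDerivAt (hv : IsRegularSolution n K v) {s : ℝ} (hs : 0 < s) :
    HasDerivAt v (deriv v s) s :=
  ((hv.contDiffOn.differentiableOn (by simp)).differentiableAt (Ioi_mem_nhds hs)).hasDerivAt

lemma hasDerivAt_flux (hv : IsRegularSolution n K v) {s : ℝ} (hs : 0 < s) :
    HasDerivAt (flux n v) (-(sourceWeight s * K s * v s ^ 3)) s := by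
  rw [← hv.deriv_flux s hs]
  exact (((contDiffOn_flux n hv.contDiffOn).differentiableOn (by simp)).differentiableAt
    (Ioi_mem_nhds hs)).hasDerivAt

lemma sourceWeight_mul_pow_pos (hv : IsRegularSolution n K v) {s : ℝ} (hs : 0 < s) :
    0 < sourceWeight s * v s ^ 3 :=
  mul_pos (sourceWeight_pos hs) (pow_pos (hv.pos s hs) 3)

lemma differentiableOn_coefficient (hv : IsRegularSolution n K v) :
    DifferentiableOn ℝ K (Ioi 0) := by
  have hflux' : DifferentiableOn ℝ (deriv (flux n v)) (Ioi 0) :=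
    ((contDiffOn_flux n hv.contDiffOn).deriv_of_isOpen isOpen_Ioi
      (by simp)).differentiableOn (n := ∞) (by simp)
  have hweight : DifferentiableOn ℝ (fun s => sourceWeight s * v s ^ 3) (Ioi 0) := by
    refine DifferentiableOn.mul (fun s hs => ?_) ((hv.contDiffOn.differentiableOn (by simp)).pow 3)
    have hs5 : s ^ 5 ≠ 0 := pow_ne_zero 5 (mem_Ioi.1 hs).ne'
    unfold sourceWeight
    fun_prop (disch := exact hs5)
  refine (hflux'.neg.div hweight fun s hs => (hv.sourceWeight_mul_pow_pos hs).ne').congr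
    fun s hs => ?_
  have hne := (hv.sourceWeight_mul_pow_pos hs).ne'
  rw [Pi.div_apply, Pi.neg_apply, hv.deriv_flux s hs, eq_div_iff hne]
  ring

lemma hasDerivAt_pohozaev (hv : IsRegularSolution n K v) (hn : 0 < n) {s : ℝ} (hs : 0 < s) :
    HasDerivAt (pohozaev n K v)
      (v s ^ 4 / 2 * (multiplier n s * (sourceWeight s * ((n * s ^ 2 + 1) / s)) * deriv K s +
        (12 * sourceWeight s +
          multiplier n s * (-(2 * n * s ^ 4 + 4 * (n + 1) * s ^ 2 + 6) / s ^ 7)) * K s)) s := by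
  have hL : HasDerivAt (multiplier n) (4 / ((n * s ^ 2 + 1) / s)) s :=
    (hasDerivAt_multiplier hn s).congr_deriv (div_div_eq_mul_div _ _ _).symm
  have hK := (hv.differentiableOn_coefficient.differentiableAt (Ioi_mem_nhds hs)).hasDerivAt
  exact hasDerivAt_pohozaev_of_ode (q := fun s => (n * s ^ 2 + 1) / s) (by positivity) hL
    (hasDerivAt_sourceWeight_mul n hs) hK (hv.hasDerivAt hs) rfl (hv.hasDerivAt_flux hs)

lemma pohozaev_eq (hv : IsRegularSolution n K v) {s : ℝ} (hs : 0 < s) :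
    pohozaev n K v s = multiplier n s *
      (flux n v s ^ 2 - (n * s ^ 2 + 1) / s * v s * deriv (flux n v) s / 2) -
        4 * v s * flux n v s := by
  rw [hv.deriv_flux s hs, pohozaev]
  ring

lemma exists_chart_zero (hv : IsRegularSolution n K v) :
    ∃ g χ : ℝ → ℝ, ContDiff ℝ ∞ g ∧ ContDiff ℝ ∞ χ ∧ 0 < χ 0 ∧
      (∀ s, 0 < s → v s = s ^ 2 * g s) ∧ ∀ s, 0 < s → flux n v s = χ s := by
  obtain ⟨g, hg, hg0, hvg⟩ := hv.regular_zero
  have := (contDiff_infty_iff_deriv.1 hg).2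
  refine ⟨g, fun s => (n * s ^ 2 + 1) * (2 * g s + s * deriv g s), hg, by fun_prop,
    by simpa using hg0, hvg, fun s hs => ?_⟩
  have hderiv : HasDerivAt v (2 * s * g s + s ^ 2 * deriv g s) s := by
    have hprod := (hasDerivAt_pow 2 s).mul (hg.differentiable (by simp) s).hasDerivAt
    refine (hprod.congr_of_eventuallyEq (eventually_of_mem (Ioi_mem_nhds hs) hvg)).congr_deriv ?_
    simp
  rw [flux, hderiv.deriv]
  field_simp

lemma exists_chart_infty (hv : IsRegularSolution n K v) :
    ∃ ψ κ : ℝ → ℝ, ContDiff ℝ ∞ ψ ∧ ContDiff ℝ ∞ κ ∧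
      (∀ s, 0 < s → v s = ψ s⁻¹) ∧ ∀ s, 0 < s → flux n v s = s⁻¹ * κ s⁻¹ := by
  obtain ⟨ψ, hψ, hvψ⟩ := hv.regular_infty
  have := (contDiff_infty_iff_deriv.1 hψ).2
  refine ⟨ψ, fun r => -((n + r ^ 2) * deriv ψ r), hψ, by fun_prop, hvψ, fun s hs => ?_⟩
  rw [flux, (hasDerivAt_of_eq_comp_inv (hψ.differentiable (by simp) s⁻¹).hasDerivAt hvψ hs).deriv]
  field_simp

lemma tendsto_pohozaev_zero (hv : IsRegularSolution n K v) (hn : 0 < n) :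
    Tendsto (pohozaev n K v) (𝓝[>] 0) (𝓝 0) := by
  obtain ⟨g, χ, hg, hχ, -, hvg, hfluxχ⟩ := hv.exists_chart_zero
  let P : ℝ → ℝ := fun s => multiplier n s *
    (χ s ^ 2 - (n * s ^ 2 + 1) * s * g s * deriv χ s / 2) - 4 * (s ^ 2 * g s) * χ s
  have hP : Continuous P := by
    have := hg.continuous
    have := hχ.continuous
    have := hχ.continuous_deriv (by simp)
    have : Continuous (multiplier n) :=
      continuous_iff_continuousAt.2 fun s => (hasDerivAt_multiplier hn s).continuousAt
    fun_prop
  refine ((hP.tendsto' 0 0 (by simp [P, multiplier])).mono_left nhdsWithin_le_nhds).congr' ?_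
  filter_upwards [self_mem_nhdsWithin] with s hs
  have hfluxχ' : flux n v =ᶠ[𝓝 s] χ := eventually_of_mem (Ioi_mem_nhds hs) hfluxχ
  rw [hv.pohozaev_eq hs, hfluxχ'.deriv_eq, hfluxχ s hs, hvg s hs]
  simp only [P]
  field_simp [(mem_Ioi.1 hs).ne']

lemma tendsto_flux_zero (hv : IsRegularSolution n K v) :
    ∃ p₀ > 0, Tendsto (flux n v) (𝓝[>] 0) (𝓝 p₀) := by
  obtain ⟨g, χ, -, hχ, hχ0, -, hfluxχ⟩ := hv.exists_chart_zero
  refine ⟨χ 0, hχ0, ((hχ.continuous.tendsto 0).mono_left nhdsWithin_le_nhds).congr' ?_⟩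
  filter_upwards [self_mem_nhdsWithin] with s hs using (hfluxχ s hs).symm

lemma tendsto_flux_atTop (hv : IsRegularSolution n K v) : Tendsto (flux n v) atTop (𝓝 0) := by
  obtain ⟨ψ, κ, -, hκ, -, hfluxκ⟩ := hv.exists_chart_infty
  have hcont : Continuous fun r => r * κ r := continuous_id.mul hκ.continuous
  refine ((hcont.tendsto' 0 0 (by simp)).comp tendsto_inv_atTop_zero).congr' ?_
  filter_upwards [eventually_gt_atTop 0] with s hs using (hfluxκ s hs).symm

lemma tendsto_pohozaev_atTop (hv : IsRegularSolution n K v) (hn : 0 < n) :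
    Tendsto (pohozaev n K v) atTop (𝓝 0) := by
  obtain ⟨ψ, κ, hψ, hκ, hvψ, hfluxκ⟩ := hv.exists_chart_infty
  let A : ℝ → ℝ := fun r => r * κ r ^ 2 + (n + r ^ 2) * ψ r * (κ r + r * deriv κ r) / 2
  let B : ℝ → ℝ := fun r => 4 * ψ r * (r * κ r)
  have hA : Continuous A := by
    have := hψ.continuous
    have := hκ.continuous
    have := hκ.continuous_deriv (by simp)
    fun_prop
  have hB : Continuous B := by
    have := hψ.continuous
    have := hκ.continuous
    fun_prop
  have hlim : Tendsto (fun r => multiplier n r⁻¹ * r * A r - B r) (𝓝[>] 0) (𝓝 0) := by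
    simpa [B] using ((tendsto_multiplier_inv_mul hn).mul (hA.tendsto 0 |>.mono_left
      nhdsWithin_le_nhds)).sub ((hB.tendsto 0).mono_left nhdsWithin_le_nhds)
  refine (hlim.comp tendsto_inv_atTop_nhdsGT_zero).congr' ?_
  filter_upwards [eventually_gt_atTop 0] with s hs
  have hderiv : deriv (flux n v) s = -(s⁻¹ ^ 2 * (κ s⁻¹ + s⁻¹ * deriv κ s⁻¹)) := by
    have hκ' := (hκ.differentiable (by simp) s⁻¹).hasDerivAt
    refine (hasDerivAt_of_eq_comp_inv ((hasDerivAt_id _).mul hκ') hfluxκ hs).deriv.trans ?_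
    simp
  rw [hv.pohozaev_eq hs, hderiv, hfluxκ s hs, hvψ s hs]
  simp only [A, B, Function.comp_apply, inv_inv]
  field_simp
  ring

lemma monotoneOn_flux (hv : IsRegularSolution n K v) {S : Set ℝ} (hS : Convex ℝ S)
    (hS0 : S ⊆ Ioi 0) (hK : ∀ s ∈ S, K s ≤ 0) : MonotoneOn (flux n v) S := by
  have hflux := contDiffOn_flux n hv.contDiffOn
  refine monotoneOn_of_deriv_nonneg hS (hflux.continuousOn.mono hS0)
    ((hflux.differentiableOn (by simp)).mono (interior_subset.trans hS0)) fun s hs => ?_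
  have hs := interior_subset hs
  rw [hv.deriv_flux s (hS0 hs), mul_right_comm, neg_nonneg]
  exact mul_nonpos_of_nonneg_of_nonpos (hv.sourceWeight_mul_pow_pos (hS0 hs)).le (hK s hs)

lemma flux_nonpos (hv : IsRegularSolution n K v) {a : ℝ} (ha : 0 < a)
    (hK : ∀ s, a ≤ s → K s ≤ 0) : flux n v a ≤ 0 := by
  have hmono := hv.monotoneOn_flux (convex_Ici a) (fun s hs => ha.trans_le hs) hK
  refine ge_of_tendsto hv.tendsto_flux_atTop ?_
  filter_upwards [eventually_ge_atTop a] with s hs using hmono self_mem_Ici hs hs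

lemma exists_coefficient_pos (hv : IsRegularSolution n K v) : ∃ s, 0 < s ∧ 0 < K s := by
  by_contra! hK
  obtain ⟨p₀, hp₀, hlim⟩ := hv.tendsto_flux_zero
  refine hp₀.not_ge (le_of_tendsto hlim ?_)
  filter_upwards [self_mem_nhdsWithin] with a ha
  exact hv.flux_nonpos ha fun s hs => hK s (lt_of_lt_of_le ha hs)

lemma pohozaev_nonneg (hv : IsRegularSolution n K v) (hn : 0 < n) {a : ℝ} (ha : 0 < a)
    (hKa : K a = 0) (hK : ∀ s, a ≤ s → K s ≤ 0) : 0 ≤ pohozaev n K v a := by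
  have hflux := mul_nonpos_of_nonneg_of_nonpos (hv.pos a ha).le (hv.flux_nonpos ha hK)
  have hsq : 0 ≤ multiplier n a * flux n v a ^ 2 :=
    mul_nonneg (multiplier_pos hn ha).le (sq_nonneg _)
  rw [pohozaev, hKa]
  linarith

lemma deriv_pohozaev_le (hv : IsRegularSolution n K v) (hn : 2 ≤ n) (hK : AntitoneOn K (Ioi 0))
    {s : ℝ} (hs : 0 < s) :
    ∃ c < 0, deriv (pohozaev n K v) s ≤ c * K s := by
  have hn0 : 0 < n := by linarith
  have hv4 : 0 < v s ^ 4 / 2 := by have := hv.pos s hs; positivity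
  have hw : 0 ≤ multiplier n s * (sourceWeight s * ((n * s ^ 2 + 1) / s)) :=
    mul_nonneg (multiplier_pos hn0 hs).le (mul_nonneg (sourceWeight_pos hs).le (by positivity))
  refine ⟨_, mul_neg_of_pos_of_neg hv4 (sourceWeight_add_multiplier_mul_neg hn hs), ?_⟩
  rw [(hv.hasDerivAt_pohozaev hn0 hs).deriv, mul_assoc (v s ^ 4 / 2), mul_add]
  have hK' : deriv K s ≤ 0 :=
    (derivWithin_of_isOpen isOpen_Ioi (mem_Ioi.2 hs)).ge.trans hK.derivWithin_nonpos
  exact add_le_of_nonpos_left (mul_nonpos_of_nonneg_of_nonpos hv4.le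
    (mul_nonpos_of_nonneg_of_nonpos hw hK'))

lemma continuousOn_pohozaev (hv : IsRegularSolution n K v) (hn : 0 < n) :
    ContinuousOn (pohozaev n K v) (Ioi 0) := fun _ hs =>
  (hv.hasDerivAt_pohozaev hn hs).continuousAt.continuousWithinAt

lemma antitoneOn_pohozaev (hv : IsRegularSolution n K v) (hn : 2 ≤ n)
    (hK : AntitoneOn K (Ioi 0)) {S : Set ℝ} (hS : Convex ℝ S) (hS0 : S ⊆ Ioi 0)
    (hKS : ∀ s ∈ S, 0 ≤ K s) : AntitoneOn (pohozaev n K v) S := by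
  have hn0 : 0 < n := by linarith
  have hint := interior_subset.trans hS0
  refine antitoneOn_of_deriv_nonpos hS ((hv.continuousOn_pohozaev hn0).mono hS0)
    (fun s hs => ((hv.hasDerivAt_pohozaev hn0 (hint hs)).differentiableAt).differentiableWithinAt)
    fun s hs => ?_
  obtain ⟨c, hc, hle⟩ := hv.deriv_pohozaev_le hn hK (hint hs)
  exact hle.trans (mul_nonpos_of_nonpos_of_nonneg hc.le (hKS s (interior_subset hs)))

lemma pohozaev_neg (hv : IsRegularSolution n K v) (hn : 2 ≤ n) (hK : AntitoneOn K (Ioi 0))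
    {s : ℝ} (hs : 0 < s) (hKs : 0 < K s) : pohozaev n K v s < 0 := by
  have hn0 : 0 < n := by linarith
  have hanti : StrictAntiOn (pohozaev n K v) (Ioc 0 s) := by
    refine strictAntiOn_of_deriv_neg (convex_Ioc 0 s)
      ((hv.continuousOn_pohozaev hn0).mono Ioc_subset_Ioi_self) fun t ht => ?_
    rw [interior_Ioc] at ht
    obtain ⟨c, hc, hle⟩ := hv.deriv_pohozaev_le hn hK ht.1
    exact hle.trans_lt (mul_neg_of_neg_of_pos hc (hKs.trans_le (hK ht.1 hs ht.2.le)))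
  have hhalf : s / 2 ∈ Ioc 0 s := ⟨by positivity, by linarith⟩
  refine (hanti hhalf ⟨hs, le_rfl⟩ (by linarith)).trans_le ?_
  refine ge_of_tendsto (hv.tendsto_pohozaev_zero hn0) ?_
  filter_upwards [Ioo_mem_nhdsGT hhalf.1] with t ht
  exact hanti.antitoneOn ⟨ht.1, ht.2.le.trans hhalf.2⟩ hhalf ht.2.le

lemma coefficient_pos (hv : IsRegularSolution n K v) (hn : 2 ≤ n) (hK : AntitoneOn K (Ioi 0))
    {b : ℝ} (hb : 0 < b) : 0 < K b := by
  by_contra! hKb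
  obtain ⟨s, hs, hKs⟩ := hv.exists_coefficient_pos
  have hsb : s ≤ b := le_of_not_ge fun hbs => (hKs.trans_le (hK hb hs hbs)).not_ge hKb
  obtain ⟨a, ha, hKa⟩ : (0 : ℝ) ∈ K '' Icc s b := by
    refine intermediate_value_Icc' hsb ?_ ⟨hKb, hKs.le⟩
    exact hv.differentiableOn_coefficient.continuousOn.mono fun t ht => hs.trans_le ht.1
  have ha0 : 0 < a := hs.trans_le ha.1
  have hnonneg := hv.pohozaev_nonneg (by linarith) ha0 hKa fun t hat =>
    (hK ha0 (ha0.trans_le hat) hat).trans_eq hKa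
  have hanti := hv.antitoneOn_pohozaev hn hK (convex_Ioc 0 a) Ioc_subset_Ioi_self fun t ht =>
    hKa.ge.trans (hK ht.1 ha0 ht.2)
  have hle := hanti ⟨hs, ha.1⟩ ⟨ha0, le_rfl⟩ ha.1
  exact (hnonneg.trans hle).not_gt (hv.pohozaev_neg hn hK hs hKs)

theorem not_antitoneOn (hv : IsRegularSolution n K v) (hn : 2 ≤ n) :
    ¬ AntitoneOn K (Ioi 0) := by
  intro hK
  have hKpos : ∀ s, 0 < s → 0 < K s := fun s hs => hv.coefficient_pos hn hK hs
  have hanti := hv.antitoneOn_pohozaev hn hK (convex_Ioi 0) Subset.rfl fun s hs => (hKpos s hs).le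
  have hneg := hv.pohozaev_neg hn hK one_pos (hKpos 1 one_pos)
  refine hneg.not_ge (le_of_tendsto (hv.tendsto_pohozaev_atTop (by linarith)) ?_)
  filter_upwards [eventually_ge_atTop 1] with s hs
  exact hanti (mem_Ioi.2 one_pos) (one_pos.trans_le hs) hs

end IsRegularSolution

/-! ### Partial derivatives -/

local notation "δ" => (1 : Matrix (Fin 4) (Fin 4) ℝ)

/-- `f` is differentiable at `x` with partial derivatives `d i`. -/
structure HasPartialsAt (f : E4 → ℝ) (d : Fin 4 → ℝ) (x : E4) : Prop where
  differentiableAt : DifferentiableAt ℝ f x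
  pd_eq : ∀ i, pd i f x = d i

lemma hasPartialsAt_of_hasFDerivAt {f : E4 → ℝ} {f' : E4 →L[ℝ] ℝ} {d : Fin 4 → ℝ} {x : E4}
    (hf : HasFDerivAt f f' x) (hd : ∀ i, f' (EuclideanSpace.single i 1) = d i) :
    HasPartialsAt f d x :=
  ⟨hf.differentiableAt, fun i => by rw [pd, hf.fderiv, hd]⟩

namespace HasPartialsAt

variable {f g : E4 → ℝ} {d e : Fin 4 → ℝ} {x : E4}

lemma fderiv_single (hf : HasPartialsAt f d x) (i : Fin 4) :
    fderiv ℝ f x (EuclideanSpace.single i 1) = d i := hf.pd_eq i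

lemma congr (hf : HasPartialsAt f d x) (hg : g =ᶠ[𝓝 x] f) (hd : ∀ i, d i = e i) :
    HasPartialsAt g e x :=
  hasPartialsAt_of_hasFDerivAt (hf.differentiableAt.hasFDerivAt.congr_of_eventuallyEq hg)
    fun i => (hf.fderiv_single i).trans (hd i)

lemma add (hf : HasPartialsAt f d x) (hg : HasPartialsAt g e x) :
    HasPartialsAt (fun y => f y + g y) (fun i => d i + e i) x :=
  hasPartialsAt_of_hasFDerivAt (hf.differentiableAt.hasFDerivAt.add hg.differentiableAt.hasFDerivAt)
    fun i => congrArg₂ (· + ·) (hf.fderiv_single i) (hg.fderiv_single i)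

lemma mul (hf : HasPartialsAt f d x) (hg : HasPartialsAt g e x) :
    HasPartialsAt (fun y => f y * g y) (fun i => d i * g x + f x * e i) x := by
  refine hasPartialsAt_of_hasFDerivAt
    (hf.differentiableAt.hasFDerivAt.mul hg.differentiableAt.hasFDerivAt) fun i => ?_
  simp only [_root_.add_apply, _root_.smul_apply, smul_eq_mul, hf.fderiv_single,
    hg.fderiv_single]
  ring

lemma scomp {φ : ℝ → ℝ} {φ' : ℝ} (hφ : HasDerivAt φ φ' (f x)) (hf : HasPartialsAt f d x) :
    HasPartialsAt (fun y => φ (f y)) (fun i => φ' * d i) x :=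
  hasPartialsAt_of_hasFDerivAt (hφ.comp_hasFDerivAt x hf.differentiableAt.hasFDerivAt)
    fun i => by simp [hf.fderiv_single]

end HasPartialsAt

lemma hasPartialsAt_const (c : ℝ) (x : E4) : HasPartialsAt (fun _ => c) (fun _ => 0) x :=
  hasPartialsAt_of_hasFDerivAt (hasFDerivAt_const c x) fun _ => rfl

lemma hasPartialsAt_mulVec (A : Matrix (Fin 4) (Fin 4) ℝ) (k : Fin 4) (x : E4) :
    HasPartialsAt (fun y => (A *ᵥ y) k) (A k) x := by
  have hA : HasFDerivAt (fun y : E4 => ∑ j, A k j * y j)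
      (∑ j, A k j • (EuclideanSpace.proj j : E4 →L[ℝ] ℝ)) x :=
    .fun_sum fun j _ => (EuclideanSpace.proj j : E4 →L[ℝ] ℝ).hasFDerivAt.const_mul (A k j)
  exact hasPartialsAt_of_hasFDerivAt hA fun i => by simp

lemma hasPartialsAt_coord (k : Fin 4) (x : E4) :
    HasPartialsAt (fun y => y k) (δ k) x := by
  simpa only [Matrix.one_mulVec] using hasPartialsAt_mulVec 1 k x

lemma hasPartialsAt_norm_sq (x : E4) : HasPartialsAt (fun y => ‖y‖ ^ 2) (fun i => 2 * x i) x :=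
  hasPartialsAt_of_hasFDerivAt (hasStrictFDerivAt_norm_sq x).hasFDerivAt fun i => by
    simp [EuclideanSpace.inner_single_right]

lemma hasPartialsAt_norm {x : E4} (hx : x ≠ 0) :
    HasPartialsAt (fun y => ‖y‖) (fun i => x i / ‖x‖) x := by
  have hne : ‖x‖ ^ 2 ≠ 0 := pow_ne_zero 2 (norm_ne_zero_iff.2 hx)
  refine (HasPartialsAt.scomp (f := fun y => ‖y‖ ^ 2) (Real.hasDerivAt_sqrt hne)
    (hasPartialsAt_norm_sq x)).congr (.of_forall fun y => (Real.sqrt_sq (norm_nonneg y)).symm)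
    fun i => ?_
  rw [Real.sqrt_sq (norm_nonneg x)]
  field_simp

lemma sum_mul_self_eq_norm_sq (x : E4) : ∑ i, x i * x i = ‖x‖ ^ 2 := by
  simp only [EuclideanSpace.real_norm_sq_eq x, ← pow_two]

/-! ### Radial Laplacians -/

lemma sum_pd_radial_mul_coord {Φ : ℝ → ℝ} {Φ' : ℝ} {x : E4} (hx : x ≠ 0)
    (hΦ : HasDerivAt Φ Φ' ‖x‖) :
    ∑ i, pd i (fun y => Φ ‖y‖ * y i) x = ‖x‖ * Φ' + 4 * Φ ‖x‖ := by
  have hpd : ∀ i, pd i (fun y => Φ ‖y‖ * y i) x = Φ' / ‖x‖ * (x i * x i) + Φ ‖x‖ := fun i => by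
    rw [((HasPartialsAt.scomp hΦ (hasPartialsAt_norm hx)).mul (hasPartialsAt_coord i x)).pd_eq i,
      Matrix.one_apply_eq]
    ring
  have := norm_ne_zero_iff.2 hx
  simp only [hpd, Finset.sum_add_distrib, ← Finset.mul_sum, sum_mul_self_eq_norm_sq,
    Finset.sum_const, Finset.card_univ, Fintype.card_fin, nsmul_eq_mul, Nat.cast_ofNat]
  field_simp

lemma laplacian_radial {g : MetricField} {D e F : ℝ → ℝ} {W' : ℝ} {x : E4} (hx : x ≠ 0)
    (hD : ∀ y, y ≠ 0 → √(g y).det = D ‖y‖)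
    (he : ∀ y : E4, y ≠ 0 → (g y)⁻¹ *ᵥ y = e ‖y‖ • y.ofLp)
    (hF : ∀ s, 0 < s → DifferentiableAt ℝ F s)
    (hW : HasDerivAt (fun s => s ^ 3 * D s * e s * deriv F s) W' ‖x‖) :
    laplacian g (fun y => F ‖y‖) x = W' / (‖x‖ ^ 3 * D ‖x‖) := by
  let W : ℝ → ℝ := fun s => s ^ 3 * D s * e s * deriv F s
  have hne := norm_ne_zero_iff.2 hx
  have hfield : ∀ i, (fun y => √(g y).det * ∑ j, (g y)⁻¹ i j * pd j (fun y => F ‖y‖) y)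
      =ᶠ[𝓝 x] fun y => W ‖y‖ / ‖y‖ ^ 4 * y i := fun i => by
    filter_upwards [isOpen_ne.mem_nhds hx] with y hy
    have hy0 := norm_pos_iff.2 hy
    have hpd : ∀ j, (g y)⁻¹ i j * pd j (fun y => F ‖y‖) y =
        deriv F ‖y‖ / ‖y‖ * ((g y)⁻¹ i j * y j) := fun j => by
      rw [(HasPartialsAt.scomp (hF _ hy0).hasDerivAt (hasPartialsAt_norm hy)).pd_eq j]
      ring
    have hradial : ∑ j, (g y)⁻¹ i j * y j = e ‖y‖ * y i := congrFun (he y hy) i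
    simp only [hpd, ← Finset.mul_sum, hradial, hD y hy, W]
    field_simp
  have hdiv := sum_pd_radial_mul_coord hx (hW.div (hasDerivAt_pow 4 ‖x‖) (pow_ne_zero 4 hne))
  have hpd : ∀ i, pd i (fun y => √(g y).det * ∑ j, (g y)⁻¹ i j * pd j (fun y => F ‖y‖) y) x =
      pd i (fun y => W ‖y‖ / ‖y‖ ^ 4 * y i) x := fun i => by rw [pd, (hfield i).fderiv_eq, pd]
  rw [laplacian, hD x hx, Finset.sum_congr rfl fun i _ => hpd i]
  refine (congrArg _ hdiv).trans ?_
  simp only [Pi.div_apply, Nat.cast_ofNat, Nat.add_one_sub_one]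
  field_simp
  ring

/-! ### `U(2)`-invariant metrics -/

/-- Multiplication by `i` on `ℂ² = ℝ⁴`. -/
def complexStructure : Matrix (Fin 4) (Fin 4) ℝ :=
  !![0, -1, 0, 0; 1, 0, 0, 0; 0, 0, 0, -1; 0, 0, 1, 0]

/-- The Hopf vector field `x ↦ i x`, tangent to the fibres of `S³ → ℙ¹`. -/
def hopf (x : E4) : Fin 4 → ℝ := complexStructure *ᵥ x

lemma hopf_eq (x : E4) : hopf x = ![-x 1, x 0, -x 3, x 2] := by
  ext i
  fin_cases i <;> simp [hopf, complexStructure, Matrix.mulVec, dotProduct, Fin.sum_univ_four]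

lemma complexStructure_antisymm (i j : Fin 4) :
    complexStructure i j = -complexStructure j i := by
  fin_cases i <;> fin_cases j <;> simp [complexStructure]

lemma sum_hopf_mul_coord (x : E4) : ∑ i, hopf x i * x i = 0 := by
  simp only [hopf_eq, Fin.sum_univ_four, Matrix.cons_val]
  ring

lemma sum_hopf_mul_self (x : E4) : ∑ i, hopf x i * hopf x i = ‖x‖ ^ 2 := by
  simp only [← sum_mul_self_eq_norm_sq, hopf_eq, Fin.sum_univ_four, Matrix.cons_val]
  ring

lemma sum_coord_mul_complexStructure (x : E4) (j : Fin 4) :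
    ∑ i, x i * complexStructure i j = -hopf x j := by
  fin_cases j <;> simp [Fin.sum_univ_four, hopf_eq, complexStructure]

lemma sum_hopf_mul_complexStructure (x : E4) (j : Fin 4) :
    ∑ i, hopf x i * complexStructure i j = x j := by
  fin_cases j <;> simp [Fin.sum_univ_four, hopf_eq, complexStructure]

/-- The `U(2)`-invariant symmetric form `a |dx|² + b (x · dx)² + c (i x · dx)²`. -/
def invariantForm (a b c : ℝ) (x : E4) : Matrix (Fin 4) (Fin 4) ℝ :=
  a • 1 + b • sq x + c • sq (hopf x)

lemma invariantForm_apply (a b c : ℝ) (x : E4) (i j : Fin 4) :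
    invariantForm a b c x i j = a * δ i j + b * (x i * x j) + c * (hopf x i * hopf x j) := rfl

lemma det_invariantForm (a b c : ℝ) (x : E4) :
    (invariantForm a b c x).det = a ^ 2 * (a + b * ‖x‖ ^ 2) * (a + c * ‖x‖ ^ 2) := by
  rw [← sum_mul_self_eq_norm_sq, Matrix.det_succ_row_zero]
  simp only [Nat.succ_eq_add_one, Nat.reduceAdd, Matrix.det_fin_three, Matrix.submatrix_apply,
    Fin.sum_univ_four, invariantForm_apply, hopf_eq, Matrix.one_apply, Matrix.cons_val,
    Fin.succAbove, Fin.reduceSucc, Fin.reduceCastSucc, Fin.reduceLT, Fin.reduceEq, reduceIte,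
    Fin.coe_ofNat_eq_mod, Nat.reduceMod]
  ring

lemma invariantForm_mulVec_self (a b c : ℝ) (x : E4) :
    invariantForm a b c x *ᵥ x = (a + b * ‖x‖ ^ 2) • x.ofLp := by
  simp only [invariantForm, sq, Matrix.add_mulVec, Matrix.smul_mulVec, Matrix.one_mulVec,
    Matrix.vecMulVec_mulVec, dotProduct, sum_mul_self_eq_norm_sq, sum_hopf_mul_coord]
  ext i
  simp only [MulOpposite.op_pow, MulOpposite.op_zero, zero_smul, smul_zero, Pi.add_apply,
    Pi.smul_apply, smul_eq_mul, MulOpposite.smul_eq_mul_unop, MulOpposite.unop_pow,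
    MulOpposite.unop_op, Pi.zero_apply, add_zero]
  ring

lemma inv_mulVec_of_mulVec_eq_smul {ι 𝕜 : Type*} [Fintype ι] [DecidableEq ι] [Field 𝕜]
    {M : Matrix ι ι 𝕜} {μ : 𝕜} {w : ι → 𝕜} (hM : IsUnit M.det) (hμ : μ ≠ 0) (h : M *ᵥ w = μ • w) :
    M⁻¹ *ᵥ w = μ⁻¹ • w := by
  rw [eq_inv_smul_iff₀ hμ, ← Matrix.mulVec_smul, ← h, Matrix.mulVec_mulVec,
    Matrix.nonsing_inv_mul _ hM, Matrix.one_mulVec]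

/-! ### The LeBrun metrics -/

lemma sq_sigma₁_add_sq_sigma₂ {x : E4} (hx : x ≠ 0) :
    sq (sigma₁ x) + sq (sigma₂ x) =
      invariantForm (1 / ‖x‖ ^ 2) (-1 / ‖x‖ ^ 4) (-1 / ‖x‖ ^ 4) x := by
  have : ‖x‖ ≠ 0 := norm_ne_zero_iff.2 hx
  have hnorm : ‖x‖ ^ 2 = x 0 * x 0 + x 1 * x 1 + x 2 * x 2 + x 3 * x 3 := by
    rw [← sum_mul_self_eq_norm_sq, Fin.sum_univ_four]
  ext i j
  rw [invariantForm_apply, hopf_eq]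
  simp only [sq, sigma₁, sigma₂, Matrix.add_apply, Matrix.vecMulVec_apply]
  field_simp
  rw [hnorm]
  fin_cases i <;> fin_cases j <;>
    simp only [Fin.reduceFinMk, Matrix.cons_val, Matrix.one_apply, Fin.reduceEq, reduceIte] <;>
    ring

lemma sq_sigma₃ (x : E4) : sq (sigma₃ x) = (1 / ‖x‖ ^ 4) • sq (hopf x) := by
  ext i j
  simp only [sq, sigma₃, hopf_eq, Matrix.smul_apply, Matrix.vecMulVec_apply, smul_eq_mul]
  ring

lemma sq_drhat (x : E4) : sq (drhat x) = (1 / ‖x‖ ^ 6) • sq x := by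
  ext i j
  simp only [sq, drhat, Matrix.smul_apply, Matrix.vecMulVec_apply, smul_eq_mul]
  ring

lemma gLEB_eq_invariantForm (n : ℕ) {x : E4} (hx : x ≠ 0) :
    gLEB n x = invariantForm ((‖x‖ ^ 2 + 1) / ‖x‖ ^ 4)
      (-(n * (‖x‖ ^ 2 + 1)) / ((n * ‖x‖ ^ 2 + 1) * ‖x‖ ^ 4))
      ((n - 2 - ‖x‖ ^ 2) / ((‖x‖ ^ 2 + 1) * ‖x‖ ^ 4)) x := by
  have : ‖x‖ ≠ 0 := norm_ne_zero_iff.2 hx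
  rw [gLEB, add_assoc (_ • sq (drhat x)), ← smul_add, sq_sigma₁_add_sq_sigma₂ hx, sq_sigma₃,
    sq_drhat]
  ext i j
  simp only [invariantForm, rhat, Matrix.add_apply, Matrix.smul_apply, smul_eq_mul]
  field_simp
  ring

lemma gLEBc_eq_invariantForm (n : ℕ) {x : E4} (hx : x ≠ 0) :
    gLEBc n x = invariantForm ((‖x‖ ^ 2 + 1) / (n * ‖x‖ ^ 2 + 1) ^ 2)
      (-(n * (‖x‖ ^ 2 + 1)) / (n * ‖x‖ ^ 2 + 1) ^ 3)
      ((n - 2 - ‖x‖ ^ 2) / ((‖x‖ ^ 2 + 1) * (n * ‖x‖ ^ 2 + 1) ^ 2)) x := by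
  have : ‖x‖ ≠ 0 := norm_ne_zero_iff.2 hx
  rw [gLEBc, gLEB_eq_invariantForm n hx]
  ext i j
  simp only [invariantForm, rhat, Matrix.add_apply, Matrix.smul_apply, smul_eq_mul]
  field_simp

lemma det_gLEB (n : ℕ) {x : E4} (hx : x ≠ 0) :
    (gLEB n x).det = ((‖x‖ ^ 2 + 1) / ‖x‖ ^ 8) ^ 2 := by
  have : ‖x‖ ≠ 0 := norm_ne_zero_iff.2 hx
  rw [gLEB_eq_invariantForm n hx, det_invariantForm]
  field_simp
  ring

lemma det_gLEBc (n : ℕ) {x : E4} (hx : x ≠ 0) :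
    (gLEBc n x).det = ((‖x‖ ^ 2 + 1) / (n * ‖x‖ ^ 2 + 1) ^ 4) ^ 2 := by
  rw [gLEBc_eq_invariantForm n hx, det_invariantForm]
  field_simp
  ring

lemma gLEB_inv_mulVec (n : ℕ) {x : E4} (hx : x ≠ 0) :
    (gLEB n x)⁻¹ *ᵥ x = ((n * ‖x‖ ^ 2 + 1) * ‖x‖ ^ 4 / (‖x‖ ^ 2 + 1)) • x.ofLp := by
  have : 0 < ‖x‖ := norm_pos_iff.2 hx
  rw [← inv_div]
  refine inv_mulVec_of_mulVec_eq_smul ?_ (by positivity) ?_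
  · rw [det_gLEB n hx, isUnit_iff_ne_zero]
    positivity
  · rw [gLEB_eq_invariantForm n hx, invariantForm_mulVec_self]
    congr 1
    field_simp
    ring

lemma gLEBc_inv_mulVec (n : ℕ) {x : E4} (hx : x ≠ 0) :
    (gLEBc n x)⁻¹ *ᵥ x = ((n * ‖x‖ ^ 2 + 1) ^ 3 / (‖x‖ ^ 2 + 1)) • x.ofLp := by
  rw [← inv_div]
  refine inv_mulVec_of_mulVec_eq_smul ?_ (by positivity) ?_
  · rw [det_gLEBc n hx, isUnit_iff_ne_zero]
    positivity
  · rw [gLEBc_eq_invariantForm n hx, invariantForm_mulVec_self]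
    congr 1
    field_simp
    ring

lemma laplacian_gLEB (n : ℕ) {F : ℝ → ℝ} {x : E4} (hx : x ≠ 0)
    (hF : ∀ s, 0 < s → DifferentiableAt ℝ F s)
    (hflux : DifferentiableAt ℝ (flux n F) ‖x‖) :
    laplacian (gLEB n) (fun y => F ‖y‖) x = deriv (flux n F) ‖x‖ / sourceWeight ‖x‖ := by
  have hx' : 0 < ‖x‖ := norm_pos_iff.2 hx
  rw [laplacian_radial (D := fun s => (s ^ 2 + 1) / s ^ 8)
    (e := fun s => (n * s ^ 2 + 1) * s ^ 4 / (s ^ 2 + 1)) (W' := deriv (flux n F) ‖x‖) hx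
    (fun y hy => by rw [det_gLEB n hy, Real.sqrt_sq (by positivity)])
    (fun y hy => gLEB_inv_mulVec n hy) hF]
  · rw [sourceWeight]
    field_simp
    ring
  · refine hflux.hasDerivAt.congr_of_eventuallyEq ?_
    filter_upwards [lt_mem_nhds hx'] with s hs
    rw [flux]
    field_simp

lemma laplacian_gLEBc (n : ℕ) {F : ℝ → ℝ} {W' : ℝ} {x : E4} (hx : x ≠ 0)
    (hF : ∀ s, 0 < s → DifferentiableAt ℝ F s)
    (hW : HasDerivAt (fun s => s ^ 3 / (n * s ^ 2 + 1) * deriv F s) W' ‖x‖) :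
    laplacian (gLEBc n) (fun y => F ‖y‖) x =
      W' * (n * ‖x‖ ^ 2 + 1) ^ 4 / (‖x‖ ^ 3 * (‖x‖ ^ 2 + 1)) := by
  rw [laplacian_radial (D := fun s => (s ^ 2 + 1) / (n * s ^ 2 + 1) ^ 4)
    (e := fun s => (n * s ^ 2 + 1) ^ 3 / (s ^ 2 + 1)) (W' := W') hx
    (fun y hy => by rw [det_gLEBc n hy, Real.sqrt_sq (by positivity)])
    (fun y hy => gLEBc_inv_mulVec n hy) hF]
  · field_simp
  · convert hW using 2 with s
    field_simp

/-! ### Christoffel symbols of `U(2)`-invariant metrics -/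

lemma hasPartialsAt_hopf (k : Fin 4) (x : E4) :
    HasPartialsAt (fun y => hopf y k) (complexStructure k) x :=
  hasPartialsAt_mulVec complexStructure k x

/-- The `l`-th partial derivative of the entry `i j` of `invariantForm a b c`, where the
coefficients are functions of `‖x‖²` with derivatives `a'`, `b'`, `c'`. -/
def invariantFormDeriv (b c a' b' c' : ℝ) (x : E4) (l i j : Fin 4) : ℝ :=
  2 * x l * invariantForm a' b' c' x i j + b * (δ i l * x j + x i * δ j l) +
    c * (complexStructure i l * hopf x j + hopf x i * complexStructure j l)

lemma hasPartialsAt_invariantForm {a b c : ℝ → ℝ} {a' b' c' : ℝ} {x : E4}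
    (ha : HasDerivAt a a' (‖x‖ ^ 2)) (hb : HasDerivAt b b' (‖x‖ ^ 2))
    (hc : HasDerivAt c c' (‖x‖ ^ 2)) (i j : Fin 4) :
    HasPartialsAt (fun y => invariantForm (a (‖y‖ ^ 2)) (b (‖y‖ ^ 2)) (c (‖y‖ ^ 2)) y i j)
      (fun l => invariantFormDeriv (b (‖x‖ ^ 2)) (c (‖x‖ ^ 2)) a' b' c' x l i j) x := by
  have ha := HasPartialsAt.scomp (f := fun y => ‖y‖ ^ 2) ha (hasPartialsAt_norm_sq x)
  have hb := HasPartialsAt.scomp (f := fun y => ‖y‖ ^ 2) hb (hasPartialsAt_norm_sq x)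
  have hc := HasPartialsAt.scomp (f := fun y => ‖y‖ ^ 2) hc (hasPartialsAt_norm_sq x)
  refine (((ha.mul (hasPartialsAt_const (δ i j) x)).add
    (hb.mul ((hasPartialsAt_coord i x).mul (hasPartialsAt_coord j x)))).add
    (hc.mul ((hasPartialsAt_hopf i x).mul (hasPartialsAt_hopf j x)))).congr
    (.of_forall fun y => invariantForm_apply _ _ _ y i j) fun l => ?_
  rw [invariantFormDeriv, invariantForm_apply]
  ring

/-- The general `U(2)`-invariant candidate for the Christoffel symbols `Γᵏᵢⱼ`, symmetric in
`i` and `j`. -/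
def invariantChristoffel (e : Fin 6 → ℝ) (x : E4) (k i j : Fin 4) : ℝ :=
  e 0 * (δ i j * x k) + e 1 * (x i * x j * x k) +
    e 2 * (x i * δ k j + x j * δ k i) + e 3 * (hopf x i * hopf x j * x k) +
    e 4 * ((x i * hopf x j + x j * hopf x i) * hopf x k) +
    e 5 * (complexStructure k i * hopf x j + complexStructure k j * hopf x i)

/-- The `m`-th partial derivative of `invariantChristoffel e`, where the coefficients `e` are
functions of `‖x‖²` with derivatives `e'`. -/
def invariantChristoffelDeriv (e e' : Fin 6 → ℝ) (x : E4) (m k i j : Fin 4) : ℝ :=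
  let J := complexStructure
  2 * x m * invariantChristoffel e' x k i j + e 0 * (δ i j * δ k m) +
    e 1 * (δ i m * x j * x k + x i * δ j m * x k + x i * x j * δ k m) +
    e 2 * (δ i m * δ k j + δ j m * δ k i) +
    e 3 * (J i m * hopf x j * x k + hopf x i * J j m * x k + hopf x i * hopf x j * δ k m) +
    e 4 * ((δ i m * hopf x j + x i * J j m + (δ j m * hopf x i + x j * J i m)) * hopf x k +
      (x i * hopf x j + x j * hopf x i) * J k m) +
    e 5 * (J k i * J j m + J k j * J i m)

lemma hasPartialsAt_invariantChristoffel {e : Fin 6 → ℝ → ℝ} {e' : Fin 6 → ℝ} {x : E4}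
    (he : ∀ r, HasDerivAt (e r) (e' r) (‖x‖ ^ 2)) (k i j : Fin 4) :
    HasPartialsAt (fun y => invariantChristoffel (fun r => e r (‖y‖ ^ 2)) y k i j)
      (fun m => invariantChristoffelDeriv (fun r => e r (‖x‖ ^ 2)) e' x m k i j) x := by
  have E := fun r => HasPartialsAt.scomp (f := fun y => ‖y‖ ^ 2) (he r) (hasPartialsAt_norm_sq x)
  have X := fun i => hasPartialsAt_coord i x
  have H := fun i => hasPartialsAt_hopf i x
  have C := fun r => hasPartialsAt_const r x
  refine (((((((E 0).mul ((C (δ i j)).mul (X k))).add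
    ((E 1).mul (((X i).mul (X j)).mul (X k)))).add
    ((E 2).mul (((X i).mul (C (δ k j))).add ((X j).mul (C (δ k i)))))).add
    ((E 3).mul (((H i).mul (H j)).mul (X k)))).add
    ((E 4).mul ((((X i).mul (H j)).add ((X j).mul (H i))).mul (H k)))).add
    ((E 5).mul (((C (complexStructure k i)).mul (H j)).add
      ((C (complexStructure k j)).mul (H i))))).congr (.of_forall fun _ => rfl) fun m => ?_
  unfold invariantChristoffelDeriv invariantChristoffel
  ring

lemma sum_mul_one_apply (f : Fin 4 → ℝ) (j : Fin 4) : ∑ m, f m * δ m j = f j :=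
  congrFun (Matrix.vecMul_one f) j

lemma sum_coord_mul_invariantChristoffel (e : Fin 6 → ℝ) (x : E4) (i j : Fin 4) :
    ∑ m, x m * invariantChristoffel e x m i j =
      invariantForm (e 0 * ‖x‖ ^ 2) (e 1 * ‖x‖ ^ 2 + 2 * e 2) (e 3 * ‖x‖ ^ 2 - 2 * e 5) x i j := by
  have expand : ∀ m, x m * invariantChristoffel e x m i j =
      invariantForm (e 0) (e 1) (e 3) x i j * (x m * x m) +
      e 2 * (x i * (x m * δ m j) + x j * (x m * δ m i)) +
      e 4 * (x i * hopf x j + x j * hopf x i) * (hopf x m * x m) +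
      e 5 * (hopf x j * (x m * complexStructure m i) +
        hopf x i * (x m * complexStructure m j)) := fun m => by
    rw [invariantChristoffel, invariantForm_apply]
    ring
  simp only [expand, Finset.sum_add_distrib, ← Finset.mul_sum, sum_mul_self_eq_norm_sq,
    sum_hopf_mul_coord, sum_coord_mul_complexStructure, sum_mul_one_apply, invariantForm_apply]
  ring

lemma sum_hopf_mul_invariantChristoffel (e : Fin 6 → ℝ) (x : E4) (i j : Fin 4) :
    ∑ m, hopf x m * invariantChristoffel e x m i j =
      (e 2 + e 4 * ‖x‖ ^ 2 + e 5) * (x i * hopf x j + x j * hopf x i) := by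
  have expand : ∀ m, hopf x m * invariantChristoffel e x m i j =
      invariantForm (e 0) (e 1) (e 3) x i j * (hopf x m * x m) +
      e 2 * (x i * (hopf x m * δ m j) + x j * (hopf x m * δ m i)) +
      e 4 * (x i * hopf x j + x j * hopf x i) * (hopf x m * hopf x m) +
      e 5 * (hopf x j * (hopf x m * complexStructure m i) +
        hopf x i * (hopf x m * complexStructure m j)) := fun m => by
    rw [invariantChristoffel, invariantForm_apply]
    ring
  simp only [expand, Finset.sum_add_distrib, ← Finset.mul_sum, sum_hopf_mul_self,
    sum_hopf_mul_coord, sum_hopf_mul_complexStructure, sum_mul_one_apply]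
  ring

lemma invariantForm_mulVec_invariantChristoffel (a b c : ℝ) (e : Fin 6 → ℝ) (x : E4)
    (l i j : Fin 4) :
    (invariantForm a b c x *ᵥ fun m => invariantChristoffel e x m i j) l =
      a * invariantChristoffel e x l i j + b * x l * invariantForm (e 0 * ‖x‖ ^ 2)
        (e 1 * ‖x‖ ^ 2 + 2 * e 2) (e 3 * ‖x‖ ^ 2 - 2 * e 5) x i j +
      c * hopf x l * ((e 2 + e 4 * ‖x‖ ^ 2 + e 5) * (x i * hopf x j + x j * hopf x i)) := by
  simp only [invariantForm, sq, Matrix.add_mulVec, Matrix.smul_mulVec, Matrix.one_mulVec,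
    Matrix.vecMulVec_mulVec, dotProduct, sum_coord_mul_invariantChristoffel,
    sum_hopf_mul_invariantChristoffel, Pi.add_apply, Pi.smul_apply, smul_eq_mul,
    MulOpposite.smul_eq_mul_unop, MulOpposite.unop_op]
  ring

lemma invariantFormDeriv_eq_mulVec {a b c a' b' c' : ℝ} {e : Fin 6 → ℝ} {x : E4}
    (h0 : e 0 * (a + b * ‖x‖ ^ 2) = b - a')
    (h1 : e 1 * (a + b * ‖x‖ ^ 2) + 2 * b * e 2 = b')
    (h2 : e 2 * a = a')
    (h3 : e 3 * (a + b * ‖x‖ ^ 2) - 2 * b * e 5 = -c')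
    (h4 : e 4 * (a + c * ‖x‖ ^ 2) + c * e 2 + c * e 5 = c')
    (h5 : e 5 * a = c) (l i j : Fin 4) :
    invariantFormDeriv b c a' b' c' x i j l + invariantFormDeriv b c a' b' c' x j i l -
        invariantFormDeriv b c a' b' c' x l i j =
      2 * (invariantForm a b c x *ᵥ fun m => invariantChristoffel e x m i j) l := by
  have δ_symm := (Matrix.isSymm_one (n := Fin 4) (α := ℝ)).apply
  rw [invariantForm_mulVec_invariantChristoffel]
  simp only [invariantFormDeriv, invariantChristoffel, invariantForm_apply]
  rw [δ_symm l j, δ_symm i j, δ_symm l i, complexStructure_antisymm j i,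
    complexStructure_antisymm i l, complexStructure_antisymm j l]
  linear_combination (-2 * δ i j * x l) * h0 - 2 * x i * x j * x l * h1
    - 2 * (x i * δ l j + x j * δ l i) * h2
    - 2 * hopf x i * hopf x j * x l * h3
    - 2 * (x i * hopf x j + x j * hopf x i) * hopf x l * h4
    - 2 * (complexStructure l i * hopf x j + complexStructure l j * hopf x i) * h5

lemma christoffel_eq_of_mulVec {g : MetricField} {x : E4} {Γ : Fin 4 → ℝ} {i j : Fin 4}
    (hdet : IsUnit (g x).det)
    (hΓ : ∀ l, pd i (fun y => g y j l) x + pd j (fun y => g y i l) x - pd l (fun y => g y i j) x =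
      2 * (g x *ᵥ Γ) l) (k : Fin 4) : christoffel g k i j x = Γ k := by
  have hinv : ∑ l, (g x)⁻¹ k l * (g x *ᵥ Γ) l = Γ k := by
    have h : (g x)⁻¹ *ᵥ (g x *ᵥ Γ) = Γ := by
      rw [Matrix.mulVec_mulVec, Matrix.nonsing_inv_mul _ hdet, Matrix.one_mulVec]
    exact congrFun h k
  simp only [christoffel, hΓ, mul_left_comm _ (2 : ℝ), ← Finset.mul_sum, hinv]
  ring

/-! ### Scalar curvature of the compactified metric -/

/-- Coefficients, as functions of `t = ‖x‖²`, of the Christoffel symbols of `gLEBc n` in terms of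
`invariantChristoffel`. -/
def christoffelCoeff (n : ℝ) : Fin 6 → ℝ → ℝ :=
  ![fun t => (n - 1) / (t + 1),
    fun t => -(n * (n - 1)) / ((n * t + 1) * (t + 1)),
    fun t => -(n * t + 2 * n - 1) / ((n * t + 1) * (t + 1)),
    fun t => (n - 1) * (n * t + 1) / (t + 1) ^ 3,
    fun t => -(n - 1) ^ 2 / ((n * t + 1) * (t + 1) ^ 2),
    fun t => (n - 2 - t) / (t + 1) ^ 2]

/-- Derivatives of `christoffelCoeff n`. -/
def christoffelCoeffDeriv (n : ℝ) : Fin 6 → ℝ → ℝ :=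
  ![fun t => -(n - 1) / (t + 1) ^ 2,
    fun t => n * (n - 1) * (2 * n * t + n + 1) / ((n * t + 1) * (t + 1)) ^ 2,
    fun t => ((n * t + 1) ^ 2 + 2 * (n - 1) * (2 * n * t + n + 1)) /
      ((n * t + 1) * (t + 1)) ^ 2,
    fun t => (n - 1) * (n - 3 - 2 * n * t) / (t + 1) ^ 4,
    fun t => (n - 1) ^ 2 * (3 * n * t + n + 2) / ((n * t + 1) ^ 2 * (t + 1) ^ 3),
    fun t => (t + 3 - 2 * n) / (t + 1) ^ 3]

lemma hasDerivAt_christoffelCoeff {n t : ℝ} (hn : 0 ≤ n) (ht : 0 ≤ t) (r : Fin 6) :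
    HasDerivAt (christoffelCoeff n r) (christoffelCoeffDeriv n r t) t := by
  have hE : n * t + 1 ≠ 0 := by positivity
  have hF : t + 1 ≠ 0 := by positivity
  have dE : HasDerivAt (fun t : ℝ => n * t + 1) n t := by
    simpa using ((hasDerivAt_id t).const_mul n).add_const 1
  have dF : HasDerivAt (fun t : ℝ => t + 1) 1 t := (hasDerivAt_id t).add_const 1
  have dEF := dE.mul dF
  have dG : HasDerivAt (fun t : ℝ => n * t + 2 * n - 1) n t := by
    simpa using (((hasDerivAt_id t).const_mul n).add_const (2 * n)).sub_const 1
  fin_cases r <;> [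
    exact ((hasDerivAt_const t (n - 1)).div dF hF).congr_deriv (by simp [christoffelCoeffDeriv]);
    refine ((hasDerivAt_const t (-(n * (n - 1)))).div dEF (mul_ne_zero hE hF)).congr_deriv ?_;
    refine (dG.neg.div dEF (mul_ne_zero hE hF)).congr_deriv ?_;
    refine ((dE.const_mul (n - 1)).div (dF.pow 3) (pow_ne_zero 3 hF)).congr_deriv ?_;
    refine ((hasDerivAt_const t (-(n - 1) ^ 2)).div (dE.mul (dF.pow 2))
      (mul_ne_zero hE (pow_ne_zero 2 hF))).congr_deriv ?_;
    refine (((hasDerivAt_id t).const_sub (n - 2)).div (dF.pow 2)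
      (pow_ne_zero 2 hF)).congr_deriv ?_]
  all_goals
    simp only [christoffelCoeffDeriv, Fin.reduceFinMk, Matrix.cons_val, Pi.mul_apply,
      Pi.pow_apply, Pi.neg_apply, id_eq, Nat.cast_ofNat, Nat.add_one_sub_one]
    field_simp
    ring

lemma pd_gLEBc (n : ℕ) {x : E4} (hx : x ≠ 0) (l i j : Fin 4) :
    pd l (fun y => gLEBc n y i j) x =
      invariantFormDeriv
        (-(n * (‖x‖ ^ 2 + 1)) / (n * ‖x‖ ^ 2 + 1) ^ 3)
        ((n - 2 - ‖x‖ ^ 2) / ((‖x‖ ^ 2 + 1) * (n * ‖x‖ ^ 2 + 1) ^ 2))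
        ((1 - 2 * n - n * ‖x‖ ^ 2) / (n * ‖x‖ ^ 2 + 1) ^ 3)
        (n * (2 * n * ‖x‖ ^ 2 + 3 * n - 1) / (n * ‖x‖ ^ 2 + 1) ^ 4)
        ((2 * n * ‖x‖ ^ 4 + (7 * n - 3 * n ^ 2) * ‖x‖ ^ 2 + (1 + 3 * n - 2 * n ^ 2)) /
          ((‖x‖ ^ 2 + 1) ^ 2 * (n * ‖x‖ ^ 2 + 1) ^ 3)) x l i j := by
  have hE : n * ‖x‖ ^ 2 + 1 ≠ 0 := by positivity
  have hF : ‖x‖ ^ 2 + 1 ≠ 0 := by positivity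
  have dE : HasDerivAt (fun t : ℝ => n * t + 1) n (‖x‖ ^ 2) := by
    simpa using ((hasDerivAt_id (‖x‖ ^ 2)).const_mul (n : ℝ)).add_const 1
  have dF : HasDerivAt (fun t : ℝ => t + 1) 1 (‖x‖ ^ 2) := (hasDerivAt_id _).add_const 1
  have ha := dF.div (dE.pow 2) (pow_ne_zero 2 hE)
  have hb := (dF.const_mul (n : ℝ)).neg.div (dE.pow 3) (pow_ne_zero 3 hE)
  have hc := ((hasDerivAt_id (‖x‖ ^ 2)).const_sub ((n : ℝ) - 2)).div (dF.mul (dE.pow 2))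
    (mul_ne_zero hF (pow_ne_zero 2 hE))
  refine ((hasPartialsAt_invariantForm (ha.congr_deriv ?_) (hb.congr_deriv ?_)
    (hc.congr_deriv ?_) i j).congr (g := fun y => gLEBc n y i j) ?_ fun _ => rfl).pd_eq l
  case refine_4 =>
    filter_upwards [isOpen_ne.mem_nhds hx] with y hy
    rw [gLEBc_eq_invariantForm n hy]
    rfl
  all_goals
    simp only [Pi.mul_apply, Pi.pow_apply, Pi.neg_apply, id_eq, Nat.cast_ofNat,
      Nat.add_one_sub_one]
    field_simp
    ring

lemma christoffel_gLEBc (n : ℕ) {x : E4} (hx : x ≠ 0) (k i j : Fin 4) :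
    christoffel (gLEBc n) k i j x =
      invariantChristoffel (fun r => christoffelCoeff n r (‖x‖ ^ 2)) x k i j := by
  have hdet : IsUnit (gLEBc n x).det := by
    rw [det_gLEBc n hx, isUnit_iff_ne_zero]
    positivity
  refine christoffel_eq_of_mulVec
    (Γ := fun k => invariantChristoffel (fun r => christoffelCoeff n r (‖x‖ ^ 2)) x k i j)
    hdet (fun l => ?_) k
  rw [pd_gLEBc n hx, pd_gLEBc n hx, pd_gLEBc n hx, gLEBc_eq_invariantForm n hx]
  refine invariantFormDeriv_eq_mulVec ?_ ?_ ?_ ?_ ?_ ?_ l i j <;>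
    simp only [christoffelCoeff, Matrix.cons_val] <;> field_simp <;> ring

/-- The Ricci tensor of a metric whose Christoffel symbols are `invariantChristoffel e`, where the
coefficients `e` are functions of `‖x‖²` with derivatives `e'`. -/
def invariantRicci (e e' : Fin 6 → ℝ) (x : E4) (i j : Fin 4) : ℝ :=
  ∑ k, (invariantChristoffelDeriv e e' x k k i j - invariantChristoffelDeriv e e' x j k i k +
    ∑ l, (invariantChristoffel e x k i j * invariantChristoffel e x l k l -
      invariantChristoffel e x k i l * invariantChristoffel e x l j k))

lemma ricci_gLEBc (n : ℕ) {x : E4} (hx : x ≠ 0) (i j : Fin 4) :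
    ricci (gLEBc n) i j x =
      invariantRicci (fun r => christoffelCoeff n r (‖x‖ ^ 2))
        (fun r => christoffelCoeffDeriv n r (‖x‖ ^ 2)) x i j := by
  have hpd : ∀ m k i j, pd m (christoffel (gLEBc n) k i j) x =
      invariantChristoffelDeriv (fun r => christoffelCoeff n r (‖x‖ ^ 2))
        (fun r => christoffelCoeffDeriv n r (‖x‖ ^ 2)) x m k i j := fun m k i j => by
    refine ((hasPartialsAt_invariantChristoffel (fun r => hasDerivAt_christoffelCoeff
      n.cast_nonneg (by positivity) r) k i j).congr ?_ fun _ => rfl).pd_eq m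
    filter_upwards [isOpen_ne.mem_nhds hx] with y hy
    exact christoffel_gLEBc n hy k i j
  simp only [ricci, invariantRicci, hpd, christoffel_gLEBc n hx]

lemma norm_single_eq {s : ℝ} (hs : 0 < s) : ‖(EuclideanSpace.single 0 s : E4)‖ = s := by
  rw [PiLp.norm_single, Real.norm_of_nonneg hs.le]

lemma single_ne_zero {s : ℝ} (hs : 0 < s) : (EuclideanSpace.single 0 s : E4) ≠ 0 := by
  rw [← norm_pos_iff, norm_single_eq hs]
  exact hs

-- Every `U(2)`-orbit meets the ray of points `(s, 0, 0, 0)`, along which the metric is diagonal.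
lemma invariantForm_single (a b c s : ℝ) :
    invariantForm a b c (EuclideanSpace.single 0 s) =
      Matrix.diagonal ![a + b * s ^ 2, a + c * s ^ 2, a, a] := by
  ext i j
  fin_cases i <;> fin_cases j <;> simp [invariantForm_apply, hopf_eq, pow_two]

lemma scalarCurvature_of_eq_diagonal {g : MetricField} {x : E4} {w : Fin 4 → ℝ}
    (hw : ∀ i, w i ≠ 0) (hg : g x = Matrix.diagonal w) :
    scalarCurvature g x = ∑ i, ricci g i i x / w i := by
  have hinv : (g x)⁻¹ = Matrix.diagonal fun i => (w i)⁻¹ := by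
    rw [hg]
    refine Matrix.inv_eq_right_inv ?_
    simp [Matrix.diagonal_mul_diagonal, hw]
  simp [scalarCurvature, hinv, Matrix.diagonal_apply, div_eq_inv_mul]

lemma invariantRicci_single_zero (c d : Fin 6 → ℝ) (s : ℝ) :
    invariantRicci c d (EuclideanSpace.single 0 s) 0 0 =
      3 * c 0 - 3 * c 2 - 3 * c 5 +
      s ^ 2 * (3 * c 0 * c 2 + c 0 * c 5 + 3 * c 1 + 3 * c 2 ^ 2 - 5 * c 4 - c 5 ^ 2 - 6 * d 2 -
        2 * d 5) +
      s ^ 4 * (c 0 * c 4 + 3 * c 1 * c 2 + c 1 * c 5 - 2 * c 4 * c 5 - 2 * d 4) +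
      s ^ 6 * (c 1 * c 4 - c 4 ^ 2) := by
  simp only [invariantRicci, invariantChristoffelDeriv, invariantChristoffel, hopf_eq,
    complexStructure, Fin.sum_univ_four, PiLp.single_apply, Matrix.one_apply, Matrix.of_apply,
    Matrix.cons_val', Matrix.cons_val_fin_one, Matrix.cons_val, Fin.reduceEq, reduceIte]
  ring

lemma invariantRicci_single_one (c d : Fin 6 → ℝ) (s : ℝ) :
    invariantRicci c d (EuclideanSpace.single 0 s) 1 1 =
      3 * c 0 - 3 * c 2 - 3 * c 5 +
      s ^ 2 * (2 * d 0 - 4 * d 5 - 3 * c 0 * c 5 + 3 * c 0 * c 2 + c 0 ^ 2 + 6 * c 3 -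
        6 * c 5 * c 2 + 4 * c 5 ^ 2 - c 1 + c 4) +
      s ^ 4 * (2 * d 3 + c 0 * c 3 + c 0 * c 1 - c 0 * c 4 - c 3 * c 5 + 3 * c 3 * c 2 -
        2 * c 5 * c 1 + 2 * c 5 * c 4) +
      s ^ 6 * (c 3 * c 1 - c 3 * c 4) := by
  simp only [invariantRicci, invariantChristoffelDeriv, invariantChristoffel, hopf_eq,
    complexStructure, Fin.sum_univ_four, PiLp.single_apply, Matrix.one_apply, Matrix.of_apply,
    Matrix.cons_val', Matrix.cons_val_fin_one, Matrix.cons_val, Fin.reduceEq, reduceIte]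
  ring

lemma invariantRicci_single_of_two_le (c d : Fin 6 → ℝ) (s : ℝ) {i : Fin 4} (hi : 2 ≤ i) :
    invariantRicci c d (EuclideanSpace.single 0 s) i i =
      3 * c 0 - 3 * c 2 - 3 * c 5 +
      s ^ 2 * (2 * d 0 + 3 * c 0 * c 2 + c 0 * c 5 + c 0 ^ 2 - c 1 - c 4) +
      s ^ 4 * (c 0 * c 1 + c 0 * c 4) := by
  obtain rfl | rfl : i = 2 ∨ i = 3 := by omega
  all_goals
    simp only [invariantRicci, invariantChristoffelDeriv, invariantChristoffel, hopf_eq,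
      complexStructure, Fin.sum_univ_four, PiLp.single_apply, Matrix.one_apply, Matrix.of_apply,
      Matrix.cons_val', Matrix.cons_val_fin_one, Matrix.cons_val, Fin.reduceEq, reduceIte]
    ring

lemma gLEBc_single (n : ℕ) {s : ℝ} (hs : 0 < s) :
    gLEBc n (EuclideanSpace.single 0 s) = Matrix.diagonal
      ![(s ^ 2 + 1) / (n * s ^ 2 + 1) ^ 3, 1 / ((s ^ 2 + 1) * (n * s ^ 2 + 1)),
        (s ^ 2 + 1) / (n * s ^ 2 + 1) ^ 2, (s ^ 2 + 1) / (n * s ^ 2 + 1) ^ 2] := by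
  rw [gLEBc_eq_invariantForm n (single_ne_zero hs), norm_single_eq hs, invariantForm_single]
  congr 2
  · field_simp
    ring
  · congr 1
    field_simp
    ring

lemma scalarCurvature_gLEBc_single (n : ℕ) {s : ℝ} (hs : 0 < s) :
    scalarCurvature (gLEBc n) (EuclideanSpace.single 0 s) =
      24 * n * (n * s ^ 2 + 1) / (s ^ 2 + 1) := by
  rw [scalarCurvature_of_eq_diagonal ?_ (gLEBc_single n hs)]
  · simp only [Fin.sum_univ_four, ricci_gLEBc n (single_ne_zero hs), norm_single_eq hs,
      invariantRicci_single_zero, invariantRicci_single_one,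
      invariantRicci_single_of_two_le _ _ _ (le_refl 2),
      invariantRicci_single_of_two_le _ _ _ (show (2 : Fin 4) ≤ 3 by decide), christoffelCoeff,
      christoffelCoeffDeriv, Matrix.cons_val]
    field_simp
    ring
  · simp only [Fin.forall_fin_succ, Matrix.cons_val_zero, Matrix.cons_val_succ, IsEmpty.forall_iff,
      and_true]
    refine ⟨?_, ?_, ?_, ?_⟩ <;> positivity

/-! ### Radial functions on the orbifold -/

lemma contDiff_single (k : Fin 4) : ContDiff ℝ ∞ fun s : ℝ => (EuclideanSpace.single k s : E4) := by
  refine contDiff_euclidean.2 fun i => ?_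
  simp only [PiLp.single_apply]
  split_ifs <;> fun_prop

lemma contDiff_radial {n : ℕ} {f : Orb n → ℝ} (hf : IsSmooth n f) : ContDiff ℝ ∞ (radial f) :=
  hf.2.2.comp (contDiff_single 0)

/-- A `U(2)`-invariant function as a function of the coordinate `r̂ = 1 / s` along a ray in a fibre
of `𝒪(-n)`, which extends it through the zero section `r̂ = 0`. -/
def fibral {n : ℕ} (f : Orb n → ℝ) (r : ℝ) : ℝ := f (chartBdl₁ n (EuclideanSpace.single 2 r))

lemma contDiff_fibral {n : ℕ} {f : Orb n → ℝ} (hf : IsSmooth n f) : ContDiff ℝ ∞ (fibral f) :=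
  hf.1.comp (contDiff_single 2)

lemma radial_eq_fibral_inv {n : ℕ} (f : Orb n → ℝ) {s : ℝ} (hs : 0 < s) :
    radial f s = fibral f s⁻¹ := by
  refine congrArg f (Quotient.sound ?_).symm
  refine ⟨s, hs, 1, ?_, ?_⟩
  · ext i
    fin_cases i <;> simp [cx, cy, Complex.ext_iff]
  · simp [cy, Complex.ext_iff, hs.ne']

lemma exists_unitary_mulVec_eq (a b : ℂ) {r : ℝ} (hr : 0 < r)
    (hab : a * star a + b * star b = (r : ℂ) ^ 2) :
    ∃ A : Matrix.unitaryGroup (Fin 2) ℂ,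
      (A : Matrix (Fin 2) (Fin 2) ℂ) *ᵥ ![a, b] = ![(r : ℂ), 0] := by
  have : (r : ℂ) ≠ 0 := by exact_mod_cast hr.ne'
  simp only [Complex.star_def] at hab
  refine ⟨⟨!![star a / r, star b / r; -b / r, a / r], ?_⟩, ?_⟩
  · rw [Matrix.mem_unitaryGroup_iff]
    ext i j
    fin_cases i <;> fin_cases j <;>
      simp only [Matrix.mul_apply, Matrix.star_apply, Fin.sum_univ_two, Matrix.one_apply,
        Matrix.of_apply, Matrix.cons_val', Matrix.cons_val_fin_one, Matrix.cons_val, Fin.zero_eta,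
        Fin.mk_one, Fin.reduceEq, reduceIte, Complex.star_def, map_div₀, map_neg,
        Complex.conj_conj, Complex.conj_ofReal] <;>
      field_simp <;> first | linear_combination hab | ring1
  · ext i
    fin_cases i <;>
      simp only [Matrix.mulVec, dotProduct, Fin.sum_univ_two, Matrix.of_apply, Matrix.cons_val',
        Matrix.cons_val_fin_one, Matrix.cons_val, Fin.zero_eta, Fin.mk_one, Complex.star_def] <;>
      field_simp <;> first | linear_combination hab | ring1

lemma apply_chartOrb {n : ℕ} {f : Orb n → ℝ} (hf : ∀ A p, f (Orb.act n A p) = f p) (x : E4) :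
    f (chartOrb n x) = radial f ‖x‖ := by
  obtain rfl | hx := eq_or_ne x 0
  · rw [norm_zero, radial]
    congr 2
    ext i
    simp
  have hnorm : cx x * star (cx x) + cy x * star (cy x) = (‖x‖ : ℂ) ^ 2 := by
    simp only [Complex.star_def, Complex.mul_conj, ← Complex.ofReal_pow, ← sum_mul_self_eq_norm_sq,
      Fin.sum_univ_four, Complex.normSq_apply, cx, cy]
    push_cast
    ring
  obtain ⟨A, hA⟩ := exists_unitary_mulVec_eq (cx x) (cy x) (norm_pos_iff.2 hx) hnorm
  rw [← hf A (chartOrb n x)]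
  refine congrArg f (congrArg (Quotient.mk (coneSetoid n)) (Subtype.ext (Prod.ext ?_ rfl)))
  refine hA.trans ?_
  ext i
  fin_cases i <;> simp [cx, cy, Complex.ext_iff]

/-! ### Reduction to the radial equation -/

lemma div_add_inv_sq_eq (n y : ℝ) {s : ℝ} (hs : 0 < s) :
    y / (n + 1 / s ^ 2) = s ^ 2 * (y / (n * s ^ 2 + 1)) := by
  field_simp

section Quotient

variable {n : ℝ} {f v : ℝ → ℝ}

lemma contDiff_div_const_mul_sq_add_one (hn : 0 ≤ n) (hf : ContDiff ℝ ∞ f) :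
    ContDiff ℝ ∞ fun s => f s / (n * s ^ 2 + 1) :=
  hf.div (by fun_prop) fun s => by positivity

lemma contDiffOn_of_eq_div (hn : 0 ≤ n) (hf : ContDiff ℝ ∞ f)
    (hv : ∀ s, 0 < s → v s = f s / (n + 1 / s ^ 2)) : ContDiffOn ℝ ∞ v (Ioi 0) :=
  ((contDiff_id.pow 2).mul (contDiff_div_const_mul_sq_add_one hn hf)).contDiffOn.congr
    fun s hs => (hv s hs).trans (div_add_inv_sq_eq n (f s) hs)

lemma flux_of_eq_div (hn : 0 ≤ n) (hv : ∀ s, 0 < s → v s = f s / (n + 1 / s ^ 2)) {s : ℝ}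
    (hs : 0 < s) (hf : DifferentiableAt ℝ f s) :
    flux n v s = 2 * f s / (n * s ^ 2 + 1) + s * deriv f s := by
  have hE : n * s ^ 2 + 1 ≠ 0 := by positivity
  have hquot := (hasDerivAt_pow 2 s).mul
    (hf.hasDerivAt.div (hasDerivAt_const_mul_sq_add_one n s) hE)
  have heq : v =ᶠ[𝓝 s] fun s => s ^ 2 * (f s / (n * s ^ 2 + 1)) :=
    eventually_of_mem (Ioi_mem_nhds hs) fun t ht =>
      (hv t ht).trans (div_add_inv_sq_eq n (f t) ht)
  rw [flux, (hquot.congr_of_eventuallyEq heq).deriv]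
  simp only [Pi.div_apply, Nat.cast_ofNat, Nat.add_one_sub_one]
  field_simp
  ring

lemma hasDerivAt_compactified_flux (hn : 0 ≤ n) (hf : ContDiff ℝ ∞ f)
    (hv : ∀ s, 0 < s → v s = f s / (n + 1 / s ^ 2)) {s : ℝ} (hs : 0 < s) :
    HasDerivAt (fun s => s ^ 3 / (n * s ^ 2 + 1) * deriv f s)
      (s ^ 2 / (n * s ^ 2 + 1) * deriv (flux n v) s +
        4 * n * s ^ 3 / (n * s ^ 2 + 1) ^ 3 * f s) s := by
  have hE : n * s ^ 2 + 1 ≠ 0 := by positivity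
  have hfd : Differentiable ℝ f := hf.differentiable (by simp)
  have dE := hasDerivAt_const_mul_sq_add_one n s
  have dflux := ((contDiffOn_flux n (contDiffOn_of_eq_div hn hf hv)).differentiableOn
    (by simp)).differentiableAt (Ioi_mem_nhds hs)
  have dlead := ((hasDerivAt_pow 2 s).div dE hE).mul dflux.hasDerivAt
  have dlower := ((hasDerivAt_pow 2 s).div (dE.pow 2) (pow_ne_zero 2 hE)).mul (hfd s).hasDerivAt
  refine ((dlead.sub (dlower.const_mul 2)).congr_of_eventuallyEq ?_).congr_deriv ?_
  · filter_upwards [Ioi_mem_nhds hs] with t ht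
    have : 0 < t := ht
    simp only [Pi.sub_apply, Pi.mul_apply, Pi.div_apply, Pi.pow_apply,
      flux_of_eq_div hn hv ht (hfd t)]
    field_simp
    ring
  · simp only [Pi.div_apply, Pi.pow_apply, flux_of_eq_div hn hv hs (hfd s), Nat.cast_ofNat,
      Nat.add_one_sub_one]
    field_simp
    ring

end Quotient

lemma isRegularSolution_of_mem_X {n : ℕ} (hn : 0 < n) {f : Orb n → ℝ} (hf : f ∈ X n)
    {K v : ℝ → ℝ} (hv : ∀ s, 0 < s → v s = radial f s / (n + 1 / s ^ 2))
    (hode : ∀ s, 0 < s → deriv (flux n v) s = -(sourceWeight s * K s * v s ^ 3)) :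
    IsRegularSolution n K v where
  pos s hs := by
    rw [hv s hs]
    exact div_pos (hf.2.2 _) (by positivity)
  deriv_flux := hode
  regular_zero := by
    refine ⟨fun s => radial f s / (n * s ^ 2 + 1),
      contDiff_div_const_mul_sq_add_one n.cast_nonneg (contDiff_radial hf.1),
      div_pos (hf.2.2 _) (by positivity), fun s hs => ?_⟩
    rw [hv s hs, div_add_inv_sq_eq _ _ hs]
  regular_infty := by
    refine ⟨fun r => fibral f r / (n + r ^ 2),
      (contDiff_fibral hf.1).div (by fun_prop) fun r => by positivity, fun s hs => ?_⟩
    simp only [hv s hs, radial_eq_fibral_inv f hs, inv_pow, one_div]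

lemma deriv_flux_of_solvesALE {n : ℕ} {K : Orb n → ℝ} {v : ℝ → ℝ}
    (hv : ContDiffOn ℝ ∞ v (Ioi 0)) (hsol : SolvesALE n K v) {s : ℝ} (hs : 0 < s) :
    deriv (flux n v) s = -(sourceWeight s * radial K s * v s ^ 3) := by
  have heq := hsol _ (single_ne_zero hs)
  rw [laplacian_gLEB n (single_ne_zero hs)
    (fun t ht => (hv.differentiableOn (by simp)).differentiableAt (Ioi_mem_nhds ht))
    (by
      rw [norm_single_eq hs]
      exact ((contDiffOn_flux n hv).differentiableOn (by simp)).differentiableAt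
        (Ioi_mem_nhds hs)),
    norm_single_eq hs, div_eq_iff (sourceWeight_pos hs).ne'] at heq
  rw [heq, radial]
  ring

lemma deriv_flux_of_solvesConf {n : ℕ} {K u : Orb n → ℝ} (hu : u ∈ X n)
    (hsol : SolvesConf n K u) {v : ℝ → ℝ}
    (hv : ∀ s, 0 < s → v s = radial u s / (n + 1 / s ^ 2)) {s : ℝ} (hs : 0 < s) :
    deriv (flux n v) s = -(sourceWeight s * radial K s * v s ^ 3) := by
  have hsmooth := contDiff_radial hu.1
  have hW := hasDerivAt_compactified_flux n.cast_nonneg hsmooth hv hs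
  have heq := hsol _ (single_ne_zero hs)
  rw [funext (apply_chartOrb hu.2.1), laplacian_gLEBc n (single_ne_zero hs)
    (fun t _ => hsmooth.differentiable (by simp) t) (by rwa [norm_single_eq hs]),
    norm_single_eq hs, scalarCurvature_gLEBc_single n hs] at heq
  change _ + _ * radial u s = radial K s * radial u s ^ 3 at heq
  have hode : deriv (flux n v) s =
      -(s * (1 + s ^ 2) / (n * s ^ 2 + 1) ^ 3) * (radial K s * radial u s ^ 3) := by
    rw [← heq]
    field_simp
    ring
  rw [hode, hv s hs, sourceWeight]
  field_simp

/-! ### Nonexistence -/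

theorem not_exists_solvesALE {n : ℕ} (hn : 2 ≤ n) {K : Orb n → ℝ}
    (hK : AntitoneOn (radial K) (Ioi 0)) : ¬ ∃ v ∈ Y n, SolvesALE n K v := by
  rintro ⟨v, ⟨f, hf, hv⟩, hsol⟩
  have hsmooth := contDiffOn_of_eq_div n.cast_nonneg (contDiff_radial hf.1) hv
  have hreg := isRegularSolution_of_mem_X (by omega) hf hv fun s hs =>
    deriv_flux_of_solvesALE hsmooth hsol hs
  exact hreg.not_antitoneOn (by exact_mod_cast hn) hK

theorem not_exists_solvesConf {n : ℕ} (hn : 2 ≤ n) {K : Orb n → ℝ}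
    (hK : AntitoneOn (radial K) (Ioi 0)) : ¬ ∃ u ∈ X n, SolvesConf n K u := by
  rintro ⟨u, hu, hsol⟩
  have hreg := isRegularSolution_of_mem_X (by omega) hu (fun _ _ => rfl) fun s hs =>
    deriv_flux_of_solvesConf hu hsol (fun _ _ => rfl) hs
  exact hreg.not_antitoneOn (by exact_mod_cast hn) hK

end LeBrun

end

theorem mainTheorem11_general (n : ℕ) (hn : 2 ≤ n) (K : LeBrun.Orb n → ℝ)
    (hK : AntitoneOn (LeBrun.radial K) (Set.Ioi 0)) :
    (¬ ∃ v ∈ LeBrun.Y n, LeBrun.SolvesALE n K v) ∧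
    (¬ ∃ u ∈ LeBrun.X n, LeBrun.SolvesConf n K u) :=
  ⟨LeBrun.not_exists_solvesALE hn hK, LeBrun.not_exists_solvesConf hn hK⟩

theorem mainTheorem11 (K : LeBrun.Orb 2 → ℝ) (hK : K ∈ LeBrun.X 2)
    (hK' : ∀ s : ℝ, 0 ≤ s → deriv (LeBrun.radial K) s ≤ 0) :
    (¬ ∃ v ∈ LeBrun.Y 2, LeBrun.SolvesALE 2 K v) ∧
    (¬ ∃ u ∈ LeBrun.X 2, LeBrun.SolvesConf 2 K u) := by
  have hsmooth := LeBrun.contDiff_radial hK.1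
  refine mainTheorem11_general 2 le_rfl K (antitoneOn_of_deriv_nonpos (convex_Ioi 0)
    hsmooth.continuous.continuousOn (hsmooth.differentiable (by simp)).differentiableOn
    fun s hs => hK' s ?_)
  rw [interior_Ioi] at hs
  exact le_of_lt hs
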